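/- **Definitions.** Let $M$ be a monoid. Write $a \le b$ ($a$ left divides $b$) if $ax=b$ for some $x\in M$, and $a \mathrel{\widetilde\le} b$ ($a$ right divides $b$) if $xa=b$ for some $x \in M$. $M$ is a *gcd-monoid* if it is cancellative, $1$ is its only invertible element, and any two elements admit a left gcd (greatest lower bound for $\le$) and a right gcd (greatest lower bound for $\widetilde\le$); right lcms $\vee$ and left lcms $\widetilde\vee$ are the corresponding least upper bounds, when they exist. $M$ is *noetherian* if proper left divisibility and proper right divisibility are both well-founded. Let $\iota: M\to \mathrm{U_{gp}}(M)$ be the canonical morphism from $M$ to its enveloping (universal) group. A *multifraction* $\underline a$ on $M$ of depth $m\ge 0$ is a sequence $(a_1,\dots,a_m)$ of elements of $M$ carrying alternating signs, the first sign being arbitrary; $a_1/a_2/a_3/\cdots$ denotes the one with signs $+,-,+,\dots$. It represents the element $\iota(a_1)^{\pm1}\cdots\iota(a_m)^{\pm1}$ of $\mathrm{U_{gp}}(M)$ (exponents given by the signs). It is *unital* if it represents $1$, and *trivial* if all its entries are $1$. For $i\ge1$ with $i+1\le m$ and $x\in M$, the rule $R_{i,x}$ maps $\underline a$ to $\underline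 b$ if $\underline b$ has the same depth and signs, $b_k=a_k$ for $k\notin\{i-1,i,i+1\}$, and, for some $x'\in M$ when $i \ge 2$: - $i\ge2$, $i$ positive: $b_{i-1}=x'a_{i-1}$, $b_ix=x'a_i=x\mathbin{\widetilde\vee}a_i$, $b_{i+1}x=a_{i+1}$; - $i\ge2$, $i$ negative: $b_{i-1}=a_{i-1}x'$, $xb_i=a_ix'=x\vee a_i$, $xb_{i+1}=a_{i+1}$; - $i=1$ positive: $b_1x=a_1$, $b_2x=a_2$; $i=1$ negative: $xb_1=a_1$, $xb_2=a_2$. *Reduction* is the rewrite system consisting of all rules $R_{i,x}$ with $x\ne1$; a multifraction is *irreducible* if no such rule applies to it. For a gcd-monoid $M$, reduction is *$p$-semi-convergent* if every multifraction $\underline a$ on $M$ of depth at most $p$ is unital if and only if it reduces, in finitely many steps, to the trivial multifraction with the same depth and signs. The *interval monoid* of a poset $P$ is generated by the intervals $[s,t]$ with $s\le t$ in $P$, subject to the relations $[s,r]=[s,t]\cdot[t,r]$ for $s\le t\le r$, and $[s,s]=1$. For even $n\ge4$, let $P_{C,n}$ be the poset with vertices $y$ and $x_i,y_i,z_i$ for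 $i$ in $\mathbb Z/n\mathbb Z$ (so $x_{n+1}=x_1$, $y_0=y_n$, etc.), whose order is generated by $x_i\le y_i\le z_i$ and $x_i\le y_{i-1}\le z_i$ for all $i$, and $x_i\le y\le z_j$ for $i$ even and $j$ odd. Let $M_{C,n}$ be its interval monoid. **Proposition.** Let $n\ge4$ be even. Then $P_{C,n}$ has $3n+1$ elements, and $M_{C,n}$ is a noetherian gcd-monoid, which embeds into its enveloping group, and for which reduction is $p$-semi-convergent for every $p<n$ but not $n$-semi-convergent. Moreover, the $n$-multifraction $$[x_1,z_2]/[x_3,z_2]/[x_3,z_4]/\cdots/[x_{n-1},z_n]/[x_1,z_n]$$ is unital, nontrivial and irreducible. For $n=4$, the fractions $[x_1,z_2]/[x_3,z_2]$ and $[x_1,z_4]/[x_3,z_4]$ are distinct and irreducible, and they represent the same element of the enveloping group of $M_{C,4}$. -/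

import Mathlib

namespace MultifractionReduction

section Divisibility

variable {M : Type*} [Monoid M]

/-- `a` left divides `b` (equivalently, `b` is a right multiple of `a`). -/
def LeftDvd (a b : M) : Prop := ∃ x, a * x = b

/-- `a` right divides `b` (equivalently, `b` is a left multiple of `a`). -/
def RightDvd (a b : M) : Prop := ∃ x, x * a = b

/-- `d` is a left gcd of `a` and `b`. -/
def IsLeftGcd (d a b : M) : Prop :=
  LeftDvd d a ∧ LeftDvd d b ∧ ∀ e, LeftDvd e a → LeftDvd e b → LeftDvd e d

/-- `d` is a right gcd of `a` and `b`. -/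
def IsRightGcd (d a b : M) : Prop :=
  RightDvd d a ∧ RightDvd d b ∧ ∀ e, RightDvd e a → RightDvd e b → RightDvd e d

/-- `m` is a right lcm of `a` and `b` (a least common upper bound for left divisibility). -/
def IsRightLcm (m a b : M) : Prop :=
  LeftDvd a m ∧ LeftDvd b m ∧ ∀ e, LeftDvd a e → LeftDvd b e → LeftDvd m e

/-- `m` is a left lcm of `a` and `b` (a least common upper bound for right divisibility). -/
def IsLeftLcm (m a b : M) : Prop :=
  RightDvd a m ∧ RightDvd b m ∧ ∀ e, RightDvd a e → RightDvd b e → RightDvd m e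

end Divisibility

/-- A gcd-monoid: a cancellative monoid in which `1` is the only invertible element and any two
elements admit a left gcd and a right gcd. -/
structure IsGcdMonoid (M : Type*) [Monoid M] : Prop where
  cancel : IsCancelMul M
  eq_one_of_isUnit : ∀ u : M, IsUnit u → u = 1
  exists_leftGcd : ∀ a b : M, ∃ d, IsLeftGcd d a b
  exists_rightGcd : ∀ a b : M, ∃ d, IsRightGcd d a b

/-- Noetherianity: the proper left and right divisibility relations are well-founded. -/
structure IsNoetherianMonoid (M : Type*) [Monoid M] : Prop where
  wf_left : WellFounded fun a b : M => LeftDvd a b ∧ a ≠ b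
  wf_right : WellFounded fun a b : M => RightDvd a b ∧ a ≠ b

section EnvelopingGroup

/-- The relators `a · b · (ab)⁻¹` of the enveloping group. -/
def envelopingRels (M : Type*) [Monoid M] : Set (FreeGroup M) :=
  {r | ∃ a b : M, r = FreeGroup.of a * FreeGroup.of b * (FreeGroup.of (a * b))⁻¹}

/-- The enveloping (universal) group of a monoid `M`. -/
abbrev EnvelopingGroup (M : Type*) [Monoid M] : Type _ := PresentedGroup (envelopingRels M)

theorem envelopingGroup_of_mul {M : Type*} [Monoid M] (a b : M) :
    (PresentedGroup.of (a * b) : EnvelopingGroup M) =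
      PresentedGroup.of a * PresentedGroup.of b := by
  have h : (PresentedGroup.mk (envelopingRels M))
      (FreeGroup.of a * FreeGroup.of b * (FreeGroup.of (a * b))⁻¹) = 1 :=
    PresentedGroup.one_of_mem ⟨a, b, rfl⟩
  rw [map_mul, map_mul, map_inv, mul_inv_eq_one] at h
  exact h.symm

/-- The canonical morphism from a monoid to its enveloping group. -/
def can (M : Type*) [Monoid M] : M →* EnvelopingGroup M where
  toFun a := PresentedGroup.of a
  map_one' := by
    have h := envelopingGroup_of_mul (1 : M) 1
    rw [mul_one] at h
    exact left_eq_mul.mp h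
  map_mul' := envelopingGroup_of_mul

end EnvelopingGroup

section Multifractions

/-- A multifraction on `M`: a finite sequence (possibly empty) of signed elements of `M` with
alternating signs, starting with either sign. The pair `(true, a)` is the positive entry `a`, the
pair `(false, a)` is the negative entry `a`. -/
def Multifraction (M : Type*) : Type _ :=
  {l : List (Bool × M) // l.IsChain fun e f => e.1 ≠ f.1}

/-- The rules `R_{i,x}` (entries are counted from 1), for `i` positive or negative, and for `i ≥ 2`
or `i = 1`. In the case `i ≥ 2`, the list `u` consists of the first `i - 2` entries. -/
inductive Rule {M : Type*} [Monoid M] :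
    ℕ → M → List (Bool × M) → List (Bool × M) → Prop
  | pos (u v : List (Bool × M)) (a₀ a₁ a₂ b₁ b₂ x x' : M)
      (hlcm : IsLeftLcm (x' * a₁) x a₁) (h₁ : b₁ * x = x' * a₁) (h₂ : b₂ * x = a₂) :
      Rule (u.length + 2) x
        (u ++ (false, a₀) :: (true, a₁) :: (false, a₂) :: v)
        (u ++ (false, x' * a₀) :: (true, b₁) :: (false, b₂) :: v)
  | neg (u v : List (Bool × M)) (a₀ a₁ a₂ b₁ b₂ x x' : M)
      (hlcm : IsRightLcm (a₁ * x') x a₁) (h₁ : x * b₁ = a₁ * x') (h₂ : x * b₂ = a₂) :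
      Rule (u.length + 2) x
        (u ++ (true, a₀) :: (false, a₁) :: (true, a₂) :: v)
        (u ++ (true, a₀ * x') :: (false, b₁) :: (true, b₂) :: v)
  | pos_one (v : List (Bool × M)) (a₁ a₂ b₁ b₂ x : M)
      (h₁ : b₁ * x = a₁) (h₂ : b₂ * x = a₂) :
      Rule 1 x ((true, a₁) :: (false, a₂) :: v) ((true, b₁) :: (false, b₂) :: v)
  | neg_one (v : List (Bool × M)) (a₁ a₂ b₁ b₂ x : M)
      (h₁ : x * b₁ = a₁) (h₂ : x * b₂ = a₂) :
      Rule 1 x ((false, a₁) :: (true, a₂) :: v) ((false, b₁) :: (true, b₂) :: v)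

namespace Multifraction

variable {M : Type*}

/-- The depth of a multifraction: the number of its entries. -/
def depth (a : Multifraction M) : ℕ := a.1.length

/-- The right fraction `a / b`, as a multifraction of depth 2. -/
def frac (a b : M) : Multifraction M := ⟨[(true, a), (false, b)], by simp⟩

variable [Monoid M]

/-- The element of the enveloping group represented by a multifraction. -/
def eval (a : Multifraction M) : EnvelopingGroup M :=
  (a.1.map fun e => if e.1 then can M e.2 else (can M e.2)⁻¹).prod

/-- A multifraction is unital if it represents `1` in the enveloping group. -/
def Unital (a : Multifraction M) : Prop := a.eval = 1

/-- A multifraction is trivial if all its entries are equal to `1`. -/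
def Trivial (a : Multifraction M) : Prop := ∀ e ∈ a.1, e.2 = 1

/-- One step of reduction: some rule `R_{i,x}` with `x ≠ 1` maps `a` to `b`. -/
def Red (a b : Multifraction M) : Prop := ∃ (i : ℕ) (x : M), x ≠ 1 ∧ Rule i x a.1 b.1

/-- A multifraction is irreducible if no rule `R_{i,x}` with `x ≠ 1` applies to it. -/
def Irreducible (a : Multifraction M) : Prop := ¬ ∃ b, Red a b

/-- The trivial multifraction with the same depth and the same signs as `a`. -/
def ones (a : Multifraction M) : Multifraction M :=
  ⟨a.1.map fun e => (e.1, 1), by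
    rw [List.isChain_map]
    exact a.2⟩

end Multifraction

/-- Reduction is `p`-semi-convergent for `M`: a multifraction of depth at most `p` is unital if and
only if it reduces to the trivial multifraction. -/
def SemiConvergentUpTo (M : Type*) [Monoid M] (p : ℕ) : Prop :=
  ∀ a : Multifraction M, a.depth ≤ p →
    (a.Unital ↔ Relation.ReflTransGen Multifraction.Red a a.ones)

end Multifractions

section IntervalMonoid

/-- The defining relations of the interval monoid, the generators being the intervals `[s, t]`
with `s ≤ t`. -/
inductive IntervalRel (P : Type*) [PartialOrder P] :
    FreeMonoid (NonemptyInterval P) → FreeMonoid (NonemptyInterval P) → Prop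
  | concat (s t r : P) (hst : s ≤ t) (htr : t ≤ r) :
      IntervalRel P (FreeMonoid.of ⟨(s, r), hst.trans htr⟩)
        (FreeMonoid.of ⟨(s, t), hst⟩ * FreeMonoid.of ⟨(t, r), htr⟩)
  | refl (s : P) : IntervalRel P (FreeMonoid.of ⟨(s, s), le_rfl⟩) 1

/-- The interval monoid of a poset. -/
abbrev IntervalMonoid (P : Type*) [PartialOrder P] : Type _ := PresentedMonoid (IntervalRel P)

/-- The element of the interval monoid of `P` given by the interval `[s, t]`. -/
def ivl {P : Type*} [PartialOrder P] (s t : P) (h : s ≤ t) : IntervalMonoid P :=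
  PresentedMonoid.of (IntervalRel P) ⟨(s, t), h⟩

end IntervalMonoid

section Necklace

/-- The vertices `x_i`, `y_i`, `z_i` (the index `i` being taken modulo `n`, so that `x_n` is `x_0`)
and the central vertex. -/
inductive PC (n : ℕ) : Type
  | x (i : ZMod n)
  | y (i : ZMod n)
  | z (i : ZMod n)
  | center

namespace PC

/-- The generating order relations. Parity of an index modulo `n` makes sense since `n` is even. -/
inductive Step (n : ℕ) : PC n → PC n → Prop
  | x_y (i : ZMod n) : Step n (x i) (y i)
  | y_z (i : ZMod n) : Step n (y i) (z i)
  | x_y_pred (i : ZMod n) : Step n (x i) (y (i - 1))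
  | y_pred_z (i : ZMod n) : Step n (y (i - 1)) (z i)
  | x_center (i : ZMod n) (hi : Even i.val) : Step n (x i) center
  | center_z (j : ZMod n) (hj : Odd j.val) : Step n center (z j)

/-- The height of a vertex. -/
def height {n : ℕ} : PC n → ℕ
  | x _ => 0
  | y _ => 1
  | z _ => 2
  | center => 1

theorem Step.height_lt {n : ℕ} {a b : PC n} (h : Step n a b) : a.height < b.height := by
  cases h <;> simp [height]

theorem eq_or_height_lt {n : ℕ} {a b : PC n} (h : Relation.ReflTransGen (Step n) a b) :
    a = b ∨ a.height < b.height := by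
  induction h with
  | refl => exact Or.inl rfl
  | tail _ hs ih =>
    rcases ih with rfl | ih
    · exact Or.inr hs.height_lt
    · exact Or.inr (ih.trans hs.height_lt)

/-- The order generated by the relations above. -/
instance (n : ℕ) : PartialOrder (PC n) where
  le := Relation.ReflTransGen (Step n)
  le_refl _ := Relation.ReflTransGen.refl
  le_trans _ _ _ := Relation.ReflTransGen.trans
  le_antisymm a b hab hba := by
    rcases eq_or_height_lt hab with h | h
    · exact h
    · rcases eq_or_height_lt hba with h' | h'
      · exact h'.symm
      · exact absurd (h.trans h') (lt_irrefl _)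

theorem x_le_z_succ {n : ℕ} (i : ZMod n) : (x i : PC n) ≤ z (i + 1) :=
  (Relation.ReflTransGen.single (Step.x_y i)).tail (by
    have h := Step.y_pred_z (i + 1)
    rwa [add_sub_cancel_right] at h)

theorem x_succ_le_z {n : ℕ} (i : ZMod n) : (x (i + 1) : PC n) ≤ z i :=
  Relation.ReflTransGen.tail (Relation.ReflTransGen.single (by
    have h := Step.x_y_pred (i + 1)
    rwa [add_sub_cancel_right] at h)) (Step.y_z i)

end PC

/-- The interval monoid of `PC n`. -/
abbrev MC (n : ℕ) : Type := IntervalMonoid (PC n)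

/-- The element `[x_i, z_{i+1}]` of `MC n`. -/
def up {n : ℕ} (i : ZMod n) : MC n := ivl (PC.x i) (PC.z (i + 1)) (PC.x_le_z_succ i)

/-- The element `[x_{i+1}, z_i]` of `MC n`. -/
def down {n : ℕ} (i : ZMod n) : MC n := ivl (PC.x (i + 1)) (PC.z i) (PC.x_succ_le_z i)

/-- The multifraction `[x_1, z_2] / [x_3, z_2] / [x_3, z_4] / ⋯ / [x_{n-1}, z_n] / [x_1, z_n]`:
the entry of index `i = k + 1` is `[x_i, z_{i+1}]` and positive if `i` is odd, it is
`[x_{i+1}, z_i]` and negative if `i` is even. -/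
def witness (n : ℕ) : Multifraction (MC n) :=
  ⟨(List.range n).map fun k =>
      if Even k then (true, up ((k + 1 : ℕ) : ZMod n)) else (false, down ((k + 1 : ℕ) : ZMod n)), by
    rw [List.isChain_map, List.isChain_iff_getElem]
    intro k hk
    by_cases h : Even k <;> simp [h, Nat.even_add_one]⟩

end Necklace

end MultifractionReduction

open MultifractionReduction

/-! The interval monoid of any poset `P` embeds in the free group on `P` by `[s, t] ↦ g_s⁻¹ g_t`: a
product of proper intervals in which no two neighbours concatenate (a normal word) becomes a freely
reduced word, so normal words are unique (`toFree_injective`). Cancellativity and the embedding into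
the enveloping group follow, and divisibility can be read off normal words (`pre_of_leftDvd`). Gcds
exist once `P` and its dual have local meets, and a strictly monotone height gives noetherianity.

Since reduction terminates and preserves the represented element, semi-convergence only asks that
irreducible unital multifractions be trivial. Take one that is not. Spelling its entries by normal
words, backwards for negative entries, gives a list of arrows with product `1` in the free group,
hence a closed path of consecutive arrows (`exists_closed_path`). Arrows inside one entry never
compose, so the path changes entry at each step: its length is at most the depth, and its inner
arrows are whole entries. Irreducibility then constrains every turn of the path, weakly at the first
one and strongly at the later ones (`Irreducible.exists_loop`).

In `P_{C,n}` the strong turns form an explicit list (`Turn`). The beads, that is, the `z_i` with `i`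
even and the `x_i` with `i` odd, form a cycle `x_1 < z_2 > x_3 < z_4 > ⋯` of length `n`. A loop of
length at least 4 must start along this cycle, because all other turns soon lead to a dead end
(`onNecklace_of_turn`). It then keeps its direction and can leave the cycle only at its last two
vertices, so it cannot close in fewer than `n` steps (`not_isIrredLoop`).

The witness runs once around the cycle and all its turns are strong, so it is irreducible. The
central vertex makes it unital: it lies over the even `x_i` and under the odd `z_j`, and together
with the `y_i` this yields a map `φ` from `P` to the enveloping group with `[s, t] = φ(s)⁻¹ φ(t)`
(`potential_of_le`), so that products along closed zigzags telescope to `1`. -/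

namespace MultifractionReduction

/-! ### Words of arrows in the free group on a poset -/

section Words

variable {P : Type*}

/-- The element `g_s⁻¹ g_t` of the free group on `P` attached to the pair `(s, t)`. -/
def arrow (e : P × P) : FreeGroup P := (FreeGroup.of e.1)⁻¹ * FreeGroup.of e.2

/-- The word in the free group spelled by a list of pairs. -/
def spell (w : List (P × P)) : List (P × Bool) := w.flatMap fun e => [(e.1, false), (e.2, true)]

theorem mk_spell (w : List (P × P)) : FreeGroup.mk (spell w) = (w.map arrow).prod := by
  induction w with
  | nil => rfl
  | cons e w ih =>
    have h : spell (e :: w) = [(e.1, false)] ++ [(e.2, true)] ++ spell w := rfl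
    rw [h, ← FreeGroup.mul_mk, ← FreeGroup.mul_mk, ih]
    rfl

/-- Signs alternate in `spell w`, so neighbours cancel exactly when their generators agree, either
inside a pair or at the junction of two pairs. -/
theorem isReduced_spell_iff (w : List (P × P)) :
    FreeGroup.IsReduced (spell w) ↔
      (∀ e ∈ w, e.1 ≠ e.2) ∧ w.IsChain fun e f => e.2 ≠ f.1 := by
  induction w with
  | nil => simp [spell]
  | cons e w ih =>
    cases w with
    | nil => simp [spell, FreeGroup.IsReduced]
    | cons f w =>
      have h : spell (e :: f :: w) =
        (e.1, false) :: (e.2, true) :: spell (f :: w) := rfl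
      have h' : spell (f :: w) = (f.1, false) :: (f.2, true) :: spell w := rfl
      rw [h]
      rw [h'] at ih ⊢
      rw [FreeGroup.isReduced_cons_cons, FreeGroup.isReduced_cons_cons, ih,
        List.isChain_cons_cons]
      simp only [List.mem_cons, forall_eq_or_imp]
      grind

theorem spell_injective : Function.Injective (spell : List (P × P) → _) := by
  intro v w h
  induction v generalizing w with
  | nil => cases w <;> simp_all [spell]
  | cons e v ih =>
    cases w with
    | nil => simp [spell] at h
    | cons f w =>
      have h1 : (e.1, false) :: (e.2, true) :: spell v = (f.1, false) :: (f.2, true) :: spell w := h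
      simp only [List.cons.injEq, Prod.mk.injEq, and_true] at h1
      rw [ih h1.2.2, Prod.ext h1.1 h1.2.1]

/-- Two words without cancellation that spell the same element of the free group coincide. -/
theorem eq_of_prod_arrow_eq {v w : List (P × P)} (hv : FreeGroup.IsReduced (spell v))
    (hw : FreeGroup.IsReduced (spell w)) (h : (v.map arrow).prod = (w.map arrow).prod) :
    v = w := by
  rw [← mk_spell, ← mk_spell] at h
  obtain ⟨c, h1, h2⟩ := FreeGroup.Red.exact.1 h
  rw [hv.red_iff_eq] at h1
  rw [hw.red_iff_eq] at h2
  exact spell_injective (h1.symm.trans h2)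

end Words

/-! ### Normal words and the embedding into the free group -/

section Basic

variable {P : Type*} [PartialOrder P]

theorem ivl_self (s : P) (h : s ≤ s) : ivl s s h = 1 :=
  PresentedMonoid.mk_eq_mk_of_rel (IntervalRel.refl s)

theorem ivl_mul_ivl {s t r : P} (h : s ≤ t) (h' : t ≤ r) :
    ivl s t h * ivl t r h' = ivl s r (h.trans h') :=
  (PresentedMonoid.mk_eq_mk_of_rel (IntervalRel.concat s t r h h')).symm

/-- A map on intervals that is compatible with concatenation extends to the interval monoid. -/
def ivlLift {N : Type*} [Monoid N] (f : ∀ s t : P, s ≤ t → N) (h1 : ∀ s, f s s le_rfl = 1)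
    (h2 : ∀ s t r (hst : s ≤ t) (htr : t ≤ r), f s r (hst.trans htr) = f s t hst * f t r htr) :
    IntervalMonoid P →* N :=
  PresentedMonoid.lift (fun I : NonemptyInterval P => f I.fst I.snd I.fst_le_snd) (by
    rintro _ _ (⟨s, t, r, hst, htr⟩ | s)
    · simpa using h2 s t r hst htr
    · simpa using h1 s)

theorem ivl_induction {p : IntervalMonoid P → Prop} (h1 : p 1)
    (h2 : ∀ s t h a, p a → p (ivl s t h * a)) (a : IntervalMonoid P) : p a := by
  obtain ⟨a, rfl⟩ := PresentedMonoid.surjective_mk a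
  induction a using FreeMonoid.recOn with
  | one => exact h1
  | of_mul I a ih =>
    rw [map_mul]
    exact h2 I.fst I.snd I.fst_le_snd _ ih

/-- The morphism from the interval monoid of `P` to the free group on `P` that maps `[s, t]` to
`g_s⁻¹ g_t`. -/
def toFree (P : Type*) [PartialOrder P] : IntervalMonoid P →* FreeGroup P :=
  ivlLift (fun s t _ => arrow (s, t)) (by simp [arrow]) (by intros; simp [arrow])

@[simp] theorem toFree_ivl (s t : P) (h : s ≤ t) : toFree P (ivl s t h) = arrow (s, t) := rfl

open scoped Classical in
/-- The interval `[s, t]`, with value `1` if `s ≤ t` fails. -/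
noncomputable def letter (e : P × P) : IntervalMonoid P :=
  if h : e.1 ≤ e.2 then ivl e.1 e.2 h else 1

theorem letter_of_le {s t : P} (h : s ≤ t) : letter (s, t) = ivl s t h := dif_pos h

/-- The product of a list of intervals. -/
noncomputable def wprod (w : List (P × P)) : IntervalMonoid P := (w.map letter).prod

@[simp] theorem wprod_nil : wprod ([] : List (P × P)) = 1 := rfl

@[simp] theorem wprod_cons (e : P × P) (w : List (P × P)) :
    wprod (e :: w) = letter e * wprod w := by simp [wprod]

@[simp] theorem wprod_append (v w : List (P × P)) :
    wprod (v ++ w) = wprod v * wprod w := by simp [wprod]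

/-- A list of proper intervals is a normal word if no two consecutive intervals can be
concatenated. -/
def Normal (w : List (P × P)) : Prop :=
  (∀ e ∈ w, e.1 < e.2) ∧ w.IsChain fun e f => e.2 ≠ f.1

theorem Normal.isReduced {w : List (P × P)} (h : Normal w) : FreeGroup.IsReduced (spell w) :=
  (isReduced_spell_iff w).2 ⟨fun e he => (h.1 e he).ne, h.2⟩

theorem normal_nil : Normal ([] : List (P × P)) := by simp [Normal]

theorem normal_singleton {e : P × P} : Normal [e] ↔ e.1 < e.2 := by simp [Normal]

theorem normal_cons_cons {e f : P × P} {w : List (P × P)} :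
    Normal (e :: f :: w) ↔ e.1 < e.2 ∧ e.2 ≠ f.1 ∧ Normal (f :: w) := by
  simp only [Normal, List.isChain_cons_cons, List.mem_cons, forall_eq_or_imp]
  tauto

theorem Normal.of_cons {e : P × P} {w : List (P × P)} (h : Normal (e :: w)) : Normal w := by
  cases w with
  | nil => exact normal_nil
  | cons f w => exact (normal_cons_cons.1 h).2.2

theorem Normal.head_lt {e : P × P} {w : List (P × P)} (h : Normal (e :: w)) : e.1 < e.2 :=
  h.1 e (by simp)

theorem toFree_wprod {w : List (P × P)} (h : Normal w) :
    toFree P (wprod w) = (w.map arrow).prod := by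
  induction w with
  | nil => simp
  | cons e w ih =>
    rw [wprod_cons, map_mul, ih h.of_cons, List.map_cons, List.prod_cons,
      letter_of_le h.head_lt.le, toFree_ivl]

/-- Every element of the interval monoid is the product of a normal word. -/
theorem exists_normal (a : IntervalMonoid P) : ∃ w, Normal w ∧ wprod w = a := by
  induction a using ivl_induction with
  | h1 => exact ⟨[], normal_nil, rfl⟩
  | h2 s t h a ih =>
    obtain ⟨w, hw, rfl⟩ := ih
    rcases h.eq_or_lt with rfl | hlt
    · exact ⟨w, hw, by rw [ivl_self, one_mul]⟩
    cases w with
    | nil => exact ⟨[(s, t)], normal_singleton.2 hlt, by simp [letter_of_le h]⟩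
    | cons e w =>
      obtain ⟨t', r⟩ := e
      have hr : t' < r := hw.head_lt
      by_cases ht : t = t'
      · subst ht
        refine ⟨(s, r) :: w, ?_, ?_⟩
        · cases w with
          | nil => exact normal_singleton.2 (hlt.trans hr)
          | cons f w =>
            rw [normal_cons_cons] at hw ⊢
            exact ⟨hlt.trans hr, hw.2⟩
        · rw [wprod_cons, wprod_cons, letter_of_le (hlt.trans hr).le, letter_of_le hr.le,
            ← mul_assoc, ivl_mul_ivl]
      · exact ⟨(s, t) :: (t', r) :: w, normal_cons_cons.2 ⟨hlt, ht, hw⟩, by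
          rw [wprod_cons _ ((t', r) :: w), letter_of_le h]⟩

theorem Normal.eq_of_toFree {v w : List (P × P)} (hv : Normal v) (hw : Normal w)
    (h : toFree P (wprod v) = toFree P (wprod w)) : v = w := by
  rw [toFree_wprod hv, toFree_wprod hw] at h
  exact eq_of_prod_arrow_eq hv.isReduced hw.isReduced h

theorem Normal.eq {v w : List (P × P)} (hv : Normal v) (hw : Normal w)
    (h : wprod v = wprod w) : v = w := hv.eq_of_toFree hw (congrArg _ h)

theorem toFree_injective : Function.Injective (toFree P) := by
  intro a b h
  obtain ⟨v, hv, rfl⟩ := exists_normal a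
  obtain ⟨w, hw, rfl⟩ := exists_normal b
  rw [hv.eq_of_toFree hw h]

theorem isCancelMul_intervalMonoid : IsCancelMul (IntervalMonoid P) where
  mul_left_cancel a b c h := toFree_injective (mul_left_cancel (a := toFree P a) (by
    simpa only [map_mul] using congrArg (toFree P) h))
  mul_right_cancel a b c h := toFree_injective (mul_right_cancel (b := toFree P a) (by
    simpa only [map_mul] using congrArg (toFree P) h))

/-- The extension of a morphism to a group to the enveloping group. -/
def envLift {M G : Type*} [Monoid M] [Group G] (f : M →* G) : EnvelopingGroup M →* G :=
  PresentedGroup.toGroup (f := f) (by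
    rintro _ ⟨a, b, rfl⟩
    simp)

@[simp] theorem envLift_can {M G : Type*} [Monoid M] [Group G] (f : M →* G) (a : M) :
    envLift f (can M a) = f a := PresentedGroup.toGroup.of _

/-- The injective morphism `toFree` factors through the enveloping group. -/
theorem can_injective : Function.Injective (can (IntervalMonoid P)) := by
  intro a b h
  have := congrArg (envLift (toFree P)) h
  simp only [envLift_can] at this
  exact toFree_injective this

theorem ivl_eq_one_iff {s t : P} (h : s ≤ t) : ivl s t h = 1 ↔ s = t := by
  refine ⟨fun h1 => ?_, fun h1 => by subst h1; exact ivl_self s h⟩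
  have := congrArg (toFree P) h1
  rw [toFree_ivl, map_one, arrow, inv_mul_eq_one] at this
  exact FreeGroup.of_injective this

theorem ivl_left_inj {s t t' : P} (h : s ≤ t) (h' : s ≤ t') :
    ivl s t h = ivl s t' h' ↔ t = t' := by
  refine ⟨fun h1 => ?_, fun h1 => by subst h1; rfl⟩
  have := congrArg (toFree P) h1
  rw [toFree_ivl, toFree_ivl, arrow, arrow, mul_right_inj] at this
  exact FreeGroup.of_injective this

end Basic

/-! ### Divisibility and left gcds in interval monoids -/

section LeftDivisibility

variable {P : Type*} [PartialOrder P]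

/-- Left divisibility on normal words. -/
inductive Pre : List (P × P) → List (P × P) → Prop
  | nil (w) : Pre [] w
  | ivl (s t r w) (h : t ≤ r) : Pre [(s, t)] ((s, r) :: w)
  | cons (e v w) (h : Pre v w) : Pre (e :: v) (e :: w)

/-- Multiplying a normal word on the left by an interval affects at most its first letter, by
merging. Hence `w` begins with `(s, t)` or with an interval extending it. -/
theorem pre_of_leftDvd {v w : List (P × P)} (hv : Normal v) (hw : Normal w)
    (h : LeftDvd (wprod v) (wprod w)) : Pre v w := by
  induction v generalizing w with
  | nil => exact .nil w
  | cons e v ih =>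
    obtain ⟨s, t⟩ := e
    have hst : s < t := hv.head_lt
    obtain ⟨c, hc⟩ := h
    obtain ⟨u, hu, huc⟩ := exists_normal (wprod v * c)
    have hpre : Pre v u := ih hv.of_cons hu ⟨c, huc.symm⟩
    rw [wprod_cons, mul_assoc, ← huc, letter_of_le hst.le] at hc
    cases u with
    | nil =>
      have : w = [(s, t)] := hw.eq (normal_singleton.2 hst) (by
        rw [← hc]; simp [letter_of_le hst.le])
      subst this
      exact .cons _ _ _ hpre
    | cons f u =>
      obtain ⟨t', r⟩ := f
      have hr : t' < r := hu.head_lt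
      by_cases ht : t = t'
      · subst ht
        have hn : Normal ((s, r) :: u) := by
          cases u with
          | nil => exact normal_singleton.2 (hst.trans hr)
          | cons f u =>
            rw [normal_cons_cons] at hu ⊢
            exact ⟨hst.trans hr, hu.2⟩
        have : w = (s, r) :: u := hw.eq hn (by
          rw [← hc, wprod_cons, wprod_cons, letter_of_le (hst.trans hr).le, letter_of_le hr.le,
            ← mul_assoc, ivl_mul_ivl])
        subst this
        cases v with
        | nil => exact .ivl _ _ _ _ hr.le
        -- If `v` were nonempty it would start at `t`, like `u`, against the normality of `(s, t) ::
        -- v`.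
        | cons g v =>
          have := (normal_cons_cons.1 hv).2.1
          cases hpre <;> simp at this
      · have : w = (s, t) :: (t', r) :: u := hw.eq (normal_cons_cons.2 ⟨hst, ht, hu⟩) (by
          rw [← hc, wprod_cons _ ((t', r) :: u), letter_of_le hst.le])
        subst this
        exact .cons _ _ _ hpre

theorem ivl_leftDvd_ivl {s t r : P} (h : s ≤ t) (h' : t ≤ r) :
    LeftDvd (ivl s t h) (ivl s r (h.trans h')) := ⟨_, ivl_mul_ivl h h'⟩

theorem LeftDvd.mul_right {M : Type*} [Monoid M] {a b : M} (h : LeftDvd a b) (c : M) :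
    LeftDvd a (b * c) := by
  obtain ⟨x, rfl⟩ := h
  exact ⟨x * c, (mul_assoc _ _ _).symm⟩

theorem LeftDvd.mul_left {M : Type*} [Monoid M] {a b : M} (h : LeftDvd a b) (c : M) :
    LeftDvd (c * a) (c * b) := by
  obtain ⟨x, rfl⟩ := h
  exact ⟨x, mul_assoc _ _ _⟩

theorem one_leftDvd {M : Type*} [Monoid M] (a : M) : LeftDvd 1 a := ⟨a, one_mul a⟩

/-- Any two elements above a given element `s` admit a meet in the set of elements above `s`. -/
def LocalMeets (P : Type*) [PartialOrder P] : Prop :=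
  ∀ s t t' : P, s ≤ t → s ≤ t' →
    ∃ w, s ≤ w ∧ w ≤ t ∧ w ≤ t' ∧ ∀ v, s ≤ v → v ≤ t → v ≤ t' → v ≤ w

/-- Compare first letters. With distinct sources only `1` divides both; equal letters pass to the
tails; with equal sources and distinct targets a common divisor has at most one letter, and the
local meet of the targets gives the largest one. -/
theorem exists_leftGcd_wprod (hP : LocalMeets P) {v w : List (P × P)} (hv : Normal v)
    (hw : Normal w) : ∃ d, IsLeftGcd d (wprod v) (wprod w) := by
  induction v generalizing w with
  | nil => exact ⟨1, one_leftDvd _, one_leftDvd _, fun e he _ => he⟩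
  | cons e v ih =>
    cases w with
    | nil => exact ⟨1, one_leftDvd _, one_leftDvd _, fun e _ he => he⟩
    | cons f w =>
      obtain ⟨s, t⟩ := e
      obtain ⟨s', t'⟩ := f
      have hst : s < t := hv.head_lt
      have hst' : s' < t' := hw.head_lt
      by_cases hs : s = s'
      swap
      · refine ⟨1, one_leftDvd _, one_leftDvd _, fun e he he' => ?_⟩
        obtain ⟨u, hu, rfl⟩ := exists_normal e
        have h1 := pre_of_leftDvd hu hv he
        have h2 := pre_of_leftDvd hu hw he'
        cases h1 with
        | nil => exact one_leftDvd _
        | ivl s t r w h =>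
          cases h2 <;> exact absurd rfl hs
        | cons e v w h =>
          cases h2 <;> exact absurd rfl hs
      subst hs
      by_cases ht : t = t'
      · subst ht
        obtain ⟨g, hg1, hg2, hg3⟩ := ih hv.of_cons hw.of_cons
        simp only [wprod_cons]
        refine ⟨letter (s, t) * g, hg1.mul_left _, hg2.mul_left _, fun e he he' => ?_⟩
        obtain ⟨u, hu, rfl⟩ := exists_normal e
        rw [← wprod_cons] at he he'
        have h1 := pre_of_leftDvd hu hv he
        have h2 := pre_of_leftDvd hu hw he'
        cases h1 with
        | nil => exact one_leftDvd _
        | ivl s r t w h =>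
          have hsr : s < r := hu.head_lt
          refine LeftDvd.mul_right ?_ _
          rw [wprod_cons, wprod_nil, mul_one, letter_of_le hsr.le, letter_of_le hst.le]
          exact ivl_leftDvd_ivl _ h
        | cons e u w h =>
          obtain ⟨x, hx⟩ := he
          obtain ⟨y, hy⟩ := he'
          have := isCancelMul_intervalMonoid (P := P)
          rw [wprod_cons, wprod_cons, mul_assoc, mul_right_inj] at hx hy
          rw [wprod_cons]
          exact (hg3 _ ⟨x, hx⟩ ⟨y, hy⟩).mul_left _
      · obtain ⟨m, hm1, hm2, hm3, hm4⟩ := hP s t t' hst.le hst'.le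
        refine ⟨ivl s m hm1, ?_, ?_, fun e he he' => ?_⟩
        · rw [wprod_cons, letter_of_le hst.le]
          exact (ivl_leftDvd_ivl _ hm2).mul_right _
        · rw [wprod_cons, letter_of_le hst'.le]
          exact (ivl_leftDvd_ivl _ hm3).mul_right _
        obtain ⟨u, hu, rfl⟩ := exists_normal e
        have h1 := pre_of_leftDvd hu hv he
        have h2 := pre_of_leftDvd hu hw he'
        have key : u = [] ∨ ∃ r, u = [(s, r)] ∧ r ≤ t ∧ r ≤ t' := by
          cases h1 with
          | nil => exact .inl rfl
          | ivl s r t w h =>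
            cases h2 with
            | ivl _ _ _ _ h' => exact .inr ⟨r, rfl, h, h'⟩
            | cons => exact .inr ⟨_, rfl, h, le_rfl⟩
          | cons e u w h =>
            cases h2 with
            | ivl _ _ _ _ h' => exact .inr ⟨_, rfl, le_rfl, h'⟩
            | cons => exact absurd rfl ht
        obtain rfl | ⟨r, rfl, hr, hr'⟩ := key
        · exact one_leftDvd _
        · have hsr : s < r := hu.head_lt
          rw [wprod_cons, wprod_nil, mul_one, letter_of_le hsr.le]
          exact ivl_leftDvd_ivl _ (hm4 r hsr.le hr hr')

theorem exists_leftGcd (hP : LocalMeets P) (a b : IntervalMonoid P) : ∃ d, IsLeftGcd d a b := by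
  obtain ⟨v, hv, rfl⟩ := exists_normal a
  obtain ⟨w, hw, rfl⟩ := exists_normal b
  exact exists_leftGcd_wprod hP hv hw

/-- A proper left divisor of an interval is an initial interval. -/
theorem eq_ivl_of_leftDvd_ivl {s t : P} (h : s ≤ t) {a : IntervalMonoid P}
    (ha : LeftDvd a (ivl s t h)) : ∃ w, ∃ hw : s ≤ w, w ≤ t ∧ a = ivl s w hw := by
  obtain ⟨u, hu, rfl⟩ := exists_normal a
  rcases h.eq_or_lt with rfl | hlt
  · rw [ivl_self, ← wprod_nil] at ha
    have := pre_of_leftDvd hu normal_nil ha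
    cases this
    exact ⟨s, le_rfl, le_rfl, (ivl_self _ _).symm⟩
  · have h0 : ivl s t h = wprod [(s, t)] := by simp [letter_of_le h]
    rw [h0] at ha
    have := pre_of_leftDvd hu (normal_singleton.2 hlt) ha
    cases this with
    | nil => exact ⟨s, le_rfl, h, (ivl_self _ _).symm⟩
    | ivl s r t w h' => exact ⟨r, hu.head_lt.le, h', by simp [letter_of_le hu.head_lt.le]⟩
    | cons e u w h' =>
      cases h'
      exact ⟨t, h, le_rfl, h0.symm⟩

/-- Two proper intervals with the same source that admit a common right multiple have targets
with a common upper bound. -/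
theorem exists_le_of_ivl_mul_eq {s t r : P} (ht : s < t) (hr : s < r) {a b : IntervalMonoid P}
    (h : ivl s t ht.le * a = ivl s r hr.le * b) : ∃ q, t ≤ q ∧ r ≤ q := by
  obtain ⟨u, hu, huc⟩ := exists_normal (ivl s t ht.le * a)
  have h1 : Pre [(s, t)] u := pre_of_leftDvd (normal_singleton.2 ht) hu
    ⟨a, by simp [letter_of_le ht.le, huc]⟩
  have h2 : Pre [(s, r)] u := pre_of_leftDvd (normal_singleton.2 hr) hu
    ⟨b, by simp [letter_of_le hr.le, huc, h]⟩
  cases h1 with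
  | ivl _ _ q w h1 =>
    cases h2 with
    | ivl _ _ _ _ h2 => exact ⟨q, h1, h2⟩
    | cons => exact ⟨_, h1, le_rfl⟩
  | cons =>
    cases h2 with
    | ivl _ _ _ _ h2 => exact ⟨_, le_rfl, h2⟩
    | cons => exact ⟨_, le_rfl, le_rfl⟩

end LeftDivisibility

/-! ### Right divisibility, through the opposite poset -/

section Duality

variable {P : Type*} [PartialOrder P]

/-- The anti-isomorphism from the interval monoid of `P` to that of the opposite poset. -/
def rev (P : Type*) [PartialOrder P] : IntervalMonoid P →* (IntervalMonoid Pᵒᵈ)ᵐᵒᵖ :=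
  ivlLift (fun s t h => .op (ivl (P := Pᵒᵈ) (OrderDual.toDual t) (OrderDual.toDual s) h))
    (fun s => congrArg MulOpposite.op (ivl_self (P := Pᵒᵈ) (OrderDual.toDual s) _))
    (fun s t r h h' => congrArg MulOpposite.op (ivl_mul_ivl (s := OrderDual.toDual r)
      (t := OrderDual.toDual t) (r := OrderDual.toDual s) h' h).symm)

/-- The interval monoid element with all intervals reversed. -/
def dual (a : IntervalMonoid P) : IntervalMonoid Pᵒᵈ := (rev P a).unop

@[simp] theorem dual_one : dual (1 : IntervalMonoid P) = 1 := by simp [dual]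

@[simp] theorem dual_mul (a b : IntervalMonoid P) : dual (a * b) = dual b * dual a := by
  simp [dual]

/-- The inverse of `dual`. -/
def undual (a : IntervalMonoid Pᵒᵈ) : IntervalMonoid P := dual (P := Pᵒᵈ) a

@[simp] theorem undual_dual (a : IntervalMonoid P) : undual (dual a) = a := by
  induction a using ivl_induction with
  | h1 => rw [dual_one]; exact dual_one
  | h2 s t h a ih =>
    rw [dual_mul, undual, dual_mul]
    exact congrArg₂ _ rfl ih

@[simp] theorem dual_undual (a : IntervalMonoid Pᵒᵈ) : dual (undual a) = a :=
  undual_dual (P := Pᵒᵈ) a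

theorem dual_injective : Function.Injective (dual : IntervalMonoid P → _) :=
  Function.LeftInverse.injective undual_dual

theorem leftDvd_dual {a b : IntervalMonoid P} : LeftDvd (dual a) (dual b) ↔ RightDvd a b := by
  constructor
  · rintro ⟨x, hx⟩
    exact ⟨undual x, dual_injective (by simpa using hx)⟩
  · rintro ⟨x, rfl⟩
    exact ⟨dual x, by simp⟩

theorem exists_rightGcd (hP : LocalMeets Pᵒᵈ) (a b : IntervalMonoid P) :
    ∃ d, IsRightGcd d a b := by
  obtain ⟨d, h1, h2, h3⟩ := exists_leftGcd hP (dual a) (dual b)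
  rw [← dual_undual d] at h1 h2 h3
  exact ⟨undual d, leftDvd_dual.1 h1, leftDvd_dual.1 h2, fun e he he' =>
    leftDvd_dual.1 (h3 _ (leftDvd_dual.2 he) (leftDvd_dual.2 he'))⟩

theorem eq_ivl_of_rightDvd_ivl {s t : P} (h : s ≤ t) {a : IntervalMonoid P}
    (ha : RightDvd a (ivl s t h)) : ∃ w, ∃ hw : w ≤ t, s ≤ w ∧ a = ivl w t hw := by
  obtain ⟨w, hw, h1, h2⟩ := eq_ivl_of_leftDvd_ivl (P := Pᵒᵈ) _ (leftDvd_dual.2 ha)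
  exact ⟨w, hw, h1, dual_injective h2⟩

theorem exists_le_of_mul_ivl_eq {s t r : P} (hs : s < t) (hr : r < t) {a b : IntervalMonoid P}
    (h : a * ivl s t hs.le = b * ivl r t hr.le) : ∃ q, q ≤ s ∧ q ≤ r := by
  have := congrArg dual h
  rw [dual_mul, dual_mul] at this
  exact exists_le_of_ivl_mul_eq (P := Pᵒᵈ) (s := OrderDual.toDual t) (t := OrderDual.toDual s)
    (r := OrderDual.toDual r) hs hr this

end Duality

/-! ### Additive lengths -/

section Length

variable {M : Type*} [Monoid M]

theorem isNoetherianMonoid_of_length (len : M → ℕ) (hmul : ∀ a b, len (a * b) = len a + len b)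
    (hone : ∀ a, len a = 0 → a = 1) : IsNoetherianMonoid M where
  wf_left := by
    refine Subrelation.wf ?_ (measure len).wf
    rintro a b ⟨⟨x, rfl⟩, h⟩
    change len a < len (a * x)
    rw [hmul]
    have : len x ≠ 0 := fun h0 => h (by rw [hone x h0, mul_one])
    omega
  wf_right := by
    refine Subrelation.wf ?_ (measure len).wf
    rintro a b ⟨⟨x, rfl⟩, h⟩
    change len a < len (x * a)
    rw [hmul]
    have : len x ≠ 0 := fun h0 => h (by rw [hone x h0, one_mul])
    omega

theorem eq_one_of_isUnit_of_length (len : M → ℕ) (hmul : ∀ a b, len (a * b) = len a + len b)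
    (hone : ∀ a, len a = 0 → a = 1) (u : M) (hu : IsUnit u) : u = 1 := by
  obtain ⟨v, hv⟩ := hu.exists_right_inv
  have h1 := hmul u v
  have h2 := hmul 1 1
  rw [hv] at h1
  rw [mul_one] at h2
  exact hone u (by omega)

end Length

/-! ### Lcms from gcds -/

section Lcm

variable {M : Type*} [Monoid M]

theorem IsGcdMonoid.eq_one_of_mul_eq_one (h : IsGcdMonoid M) {y r : M} (hy : y * r = 1) :
    r = 1 := by
  have := h.cancel
  have hr : r * y = 1 := by
    apply mul_right_cancel (b := r)
    rw [mul_assoc, hy, mul_one, one_mul]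
  exact h.eq_one_of_isUnit r ⟨⟨r, y, hr, hy⟩, rfl⟩

/-- In a gcd-monoid, two elements with a common right multiple admit a right lcm. -/
theorem IsGcdMonoid.exists_rightLcm (h : IsGcdMonoid M) {a b c : M} (ha : LeftDvd a c)
    (hb : LeftDvd b c) : ∃ m, IsRightLcm m a b := by
  have := h.cancel
  obtain ⟨p₀, rfl⟩ := ha
  obtain ⟨q₀, hq₀⟩ := hb
  -- Removing the right gcd `d` of the two complements yields the candidate `a * p = b * q`.
  obtain ⟨d, ⟨p, rfl⟩, ⟨q, rfl⟩, hd⟩ := h.exists_rightGcd p₀ q₀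
  rw [← mul_assoc, ← mul_assoc, mul_left_inj] at hq₀
  refine ⟨a * p, ⟨p, rfl⟩, ⟨q, hq₀⟩, ?_⟩
  rintro e ⟨p', rfl⟩ ⟨q', hq'⟩
  -- The left gcd `k` of the candidate and another common multiple is again a common multiple. The
  -- factor `r` by which it falls short right divides `p` and `q`, so `r = 1` by maximality of `d`.
  obtain ⟨k, hk1, hk2, hk3⟩ := h.exists_leftGcd (a * p) (a * p')
  obtain ⟨g, rfl⟩ := hk3 a ⟨p, rfl⟩ ⟨p', rfl⟩
  obtain ⟨g', hg'⟩ := hk3 b ⟨q, hq₀⟩ ⟨q', hq'⟩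
  obtain ⟨r, hr⟩ := hk1
  have h1 : p = g * r := by
    rw [mul_assoc, mul_right_inj] at hr
    exact hr.symm
  have h2 : q = g' * r := by
    rw [← hg', ← hq₀, mul_assoc, mul_right_inj] at hr
    exact hr.symm
  obtain ⟨y, hy⟩ := hd (r * d) ⟨g, by rw [h1, mul_assoc]⟩ ⟨g', by rw [h2, mul_assoc]⟩
  have hr1 : r = 1 := by
    refine h.eq_one_of_mul_eq_one (y := y) ?_
    apply mul_right_cancel (b := d)
    rw [mul_assoc, hy, one_mul]
  rw [hr1, mul_one] at hr
  rw [← hr]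
  exact hk2

/-- In a gcd-monoid, two elements with a common left multiple admit a left lcm. -/
theorem IsGcdMonoid.exists_leftLcm (h : IsGcdMonoid M) {a b c : M} (ha : RightDvd a c)
    (hb : RightDvd b c) : ∃ m, IsLeftLcm m a b := by
  have := h.cancel
  obtain ⟨p₀, rfl⟩ := ha
  obtain ⟨q₀, hq₀⟩ := hb
  obtain ⟨d, ⟨p, rfl⟩, ⟨q, rfl⟩, hd⟩ := h.exists_leftGcd p₀ q₀
  rw [mul_assoc, mul_assoc, mul_right_inj] at hq₀
  refine ⟨p * a, ⟨p, rfl⟩, ⟨q, hq₀⟩, ?_⟩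
  rintro e ⟨p', rfl⟩ ⟨q', hq'⟩
  obtain ⟨k, hk1, hk2, hk3⟩ := h.exists_rightGcd (p * a) (p' * a)
  obtain ⟨g, rfl⟩ := hk3 a ⟨p, rfl⟩ ⟨p', rfl⟩
  obtain ⟨g', hg'⟩ := hk3 b ⟨q, hq₀⟩ ⟨q', hq'⟩
  obtain ⟨r, hr⟩ := hk1
  have h1 : p = r * g := by
    rw [← mul_assoc, mul_left_inj] at hr
    exact hr.symm
  have h2 : q = r * g' := by
    rw [← hg', ← hq₀, ← mul_assoc, mul_left_inj] at hr
    exact hr.symm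
  obtain ⟨y, hy⟩ := hd (d * r) ⟨g, by rw [h1, mul_assoc]⟩ ⟨g', by rw [h2, mul_assoc]⟩
  have hr1 : r * y = 1 := by
    apply mul_left_cancel (a := d)
    rw [← mul_assoc, hy, mul_one]
  have hr1 : r = 1 := by
    have hy1 := h.eq_one_of_mul_eq_one hr1
    rw [← hr1, hy1, mul_one]
  rw [hr1, one_mul] at hr
  rw [← hr]
  exact hk2

end Lcm

/-! ### Invariants and termination of reduction; irreducible multifractions -/

section Reduction

variable {M : Type*} [Monoid M]

/-- The element of the enveloping group represented by a list of signed elements. -/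
def evalList (l : List (Bool × M)) : EnvelopingGroup M :=
  (l.map fun e => if e.1 then can M e.2 else (can M e.2)⁻¹).prod

theorem Rule.evalList_eq {i : ℕ} {x : M} {l l' : List (Bool × M)} (h : Rule i x l l') :
    evalList l' = evalList l := by
  cases h with
  | pos u v a₀ a₁ a₂ b₁ b₂ x x' hlcm h₁ h₂ =>
    have h := congrArg (can M) h₁
    rw [map_mul, map_mul, ← eq_mul_inv_iff_mul_eq] at h
    subst h₂
    simp [evalList, h, mul_assoc]
  | neg u v a₀ a₁ a₂ b₁ b₂ x x' hlcm h₁ h₂ =>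
    have h := congrArg (can M) h₁
    rw [map_mul, map_mul, ← eq_inv_mul_iff_mul_eq] at h
    subst h₂
    simp [evalList, h, mul_assoc]
  | pos_one v a₁ a₂ b₁ b₂ x h₁ h₂ =>
    subst h₁ h₂
    simp [evalList, mul_assoc]
  | neg_one v a₁ a₂ b₁ b₂ x h₁ h₂ =>
    subst h₁ h₂
    simp [evalList, mul_assoc]

theorem Rule.map_fst {i : ℕ} {x : M} {l l' : List (Bool × M)} (h : Rule i x l l') :
    l'.map Prod.fst = l.map Prod.fst := by
  cases h <;> simp

theorem Rule.length_eq {i : ℕ} {x : M} {l l' : List (Bool × M)} (h : Rule i x l l') :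
    l'.length = l.length := by
  simpa using congrArg List.length h.map_fst

theorem Rule.isChain {i : ℕ} {x : M} {l l' : List (Bool × M)} (h : Rule i x l l')
    (hl : l.IsChain fun e f => e.1 ≠ f.1) : l'.IsChain fun e f => e.1 ≠ f.1 := by
  rw [← List.isChain_map (R := fun a b : Bool => a ≠ b) Prod.fst] at hl ⊢
  rwa [h.map_fst]

/-- The entries of index larger than `i + 1` are unchanged under a rule `R_{i,x}`, and the entry
of index `i + 1` is divided by `x`. -/
theorem Rule.getElem {i : ℕ} {x : M} {l l' : List (Bool × M)} (h : Rule i x l l') :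
    (∃ s a b, l[i]? = some (s, a) ∧ l'[i]? = some (s, b) ∧ (b * x = a ∨ x * b = a)) ∧
      ∀ j, i < j → l'[j]? = l[j]? := by
  cases h with
  | pos u v a₀ a₁ a₂ b₁ b₂ x x' hlcm h₁ h₂ =>
    refine ⟨⟨false, a₂, b₂, by simp, by simp, .inl h₂⟩, fun j hj => ?_⟩
    obtain ⟨k, rfl⟩ := Nat.exists_eq_add_of_lt hj
    rw [List.getElem?_append_right (by omega), List.getElem?_append_right (by omega)]
    have : u.length + 2 + k + 1 - u.length = k + 3 := by omega
    simp [this]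
  | neg u v a₀ a₁ a₂ b₁ b₂ x x' hlcm h₁ h₂ =>
    refine ⟨⟨true, a₂, b₂, by simp, by simp, .inr h₂⟩, fun j hj => ?_⟩
    obtain ⟨k, rfl⟩ := Nat.exists_eq_add_of_lt hj
    rw [List.getElem?_append_right (by omega), List.getElem?_append_right (by omega)]
    have : u.length + 2 + k + 1 - u.length = k + 3 := by omega
    simp [this]
  | pos_one v a₁ a₂ b₁ b₂ x h₁ h₂ =>
    refine ⟨⟨false, a₂, b₂, by simp, by simp, .inl h₂⟩, fun j hj => ?_⟩
    obtain ⟨k, rfl⟩ := Nat.exists_eq_add_of_lt hj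
    have : 1 + k + 1 = k + 2 := by omega
    simp [this]
  | neg_one v a₁ a₂ b₁ b₂ x h₁ h₂ =>
    refine ⟨⟨true, a₂, b₂, by simp, by simp, .inr h₂⟩, fun j hj => ?_⟩
    obtain ⟨k, rfl⟩ := Nat.exists_eq_add_of_lt hj
    have : 1 + k + 1 = k + 2 := by omega
    simp [this]

namespace Multifraction

theorem Red.unital_iff {a b : Multifraction M} (h : Red a b) : b.Unital ↔ a.Unital := by
  obtain ⟨i, x, -, h⟩ := h
  have : b.eval = a.eval := h.evalList_eq
  rw [Unital, Unital, this]

theorem Red.depth_eq {a b : Multifraction M} (h : Red a b) : b.depth = a.depth := by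
  obtain ⟨i, x, -, h⟩ := h
  exact h.length_eq

theorem Red.ones_eq {a b : Multifraction M} (h : Red a b) : b.ones = a.ones := by
  obtain ⟨i, x, -, h⟩ := h
  apply Subtype.ext
  have := congrArg (List.map fun s : Bool => (s, (1 : M))) h.map_fst
  simpa [ones, Function.comp_def] using this

theorem ones_unital (a : Multifraction M) : a.ones.Unital := by
  have : ∀ l : List (Bool × M), evalList (l.map fun e => (e.1, (1 : M))) = 1 := by
    intro l
    induction l with
    | nil => simp [evalList]
    | cons e l ih =>
      simp only [evalList, List.map_cons, List.prod_cons] at ih ⊢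
      rw [ih]
      simp
  exact this a.1

theorem Trivial.eq_ones {a : Multifraction M} (h : a.Trivial) : a = a.ones := by
  apply Subtype.ext
  simp only [ones]
  conv_lhs => rw [← List.map_id a.1]
  exact List.map_congr_left fun e he => Prod.ext rfl (h e he)

theorem ones_trivial (a : Multifraction M) : a.ones.Trivial := by
  intro e he
  simp only [ones, List.mem_map] at he
  obtain ⟨f, -, rfl⟩ := he
  rfl

/-- Compare the lengths of the entries lexicographically from the last entry: `R_{i,x}` shortens the
entry of index `i + 1` and fixes the later ones, so it is harmless that earlier entries may grow. -/
theorem wf_red (len : M → ℕ) (hmul : ∀ a b, len (a * b) = len a + len b)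
    (hone : ∀ a, len a = 0 → a = 1) (m : ℕ) :
    WellFounded fun b a : Multifraction M => a.depth = m ∧ Red a b := by
  refine Subrelation.wf ?_ (InvImage.wf
    (fun (a : Multifraction M) (i : Fin m) => (a.1[(i : ℕ)]?.elim 0 fun e => len e.2))
    (Pi.Lex.wellFounded (r := fun i j : Fin m => j < i) (s := fun {_} => (· < · : ℕ → ℕ → Prop))
      fun _ => Nat.lt_wfRel.wf))
  rintro b a ⟨hm, i, x, hx, h⟩
  obtain ⟨⟨s, a', b', h1, h2, h3⟩, h4⟩ := h.getElem
  have hi : i < m := by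
    rw [← hm]
    exact (List.getElem?_eq_some_iff.1 h1).1
  -- List positions start at 0, so position `i` holds the entry of index `i + 1`.
  refine ⟨⟨i, hi⟩, fun j hj => ?_, ?_⟩
  · change (b.1[(j : ℕ)]?.elim 0 fun e => len e.2) = (a.1[(j : ℕ)]?.elim 0 fun e => len e.2)
    rw [h4 j hj]
  · simp only [h1, h2, Option.elim_some]
    have : len x ≠ 0 := fun h0 => hx (hone x h0)
    rcases h3 with rfl | rfl <;> rw [hmul] <;> omega

end Multifraction

open Multifraction in
theorem semiConvergentUpTo_of_trivial (len : M → ℕ) (hmul : ∀ a b, len (a * b) = len a + len b)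
    (hone : ∀ a, len a = 0 → a = 1) (p : ℕ)
    (h : ∀ a : Multifraction M, a.depth ≤ p → a.Unital → a.Irreducible → a.Trivial) :
    SemiConvergentUpTo M p := by
  intro a ha
  constructor
  · intro hu
    obtain ⟨m, hm⟩ : ∃ m, a.depth = m := ⟨_, rfl⟩
    induction a using (wf_red len hmul hone m).induction with
    | h a ih =>
      by_cases hi : a.Irreducible
      · rw [← (h a ha hu hi).eq_ones]
      · obtain ⟨b, hb⟩ := not_not.1 hi
        refine .head hb ?_
        rw [← hb.ones_eq]
        exact ih b ⟨hm, hb⟩ (hb.depth_eq.trans_le ha) (hb.unital_iff.2 hu) (hb.depth_eq.trans hm)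
  · intro hr
    have : ∀ b c : Multifraction M, Relation.ReflTransGen Red b c → c.Unital → b.Unital := by
      intro b c hbc hc
      induction hbc using Relation.ReflTransGen.head_induction_on with
      | refl => exact hc
      | head h1 _ ih => exact h1.unital_iff.1 ih
    exact this _ _ hr (ones_unital a)

/-- Division on the side relevant for the rules at an entry of sign `s`. -/
def SignDvd (s : Bool) (x a : M) : Prop := if s then RightDvd x a else LeftDvd x a

namespace Multifraction

theorem Irreducible.eq_one_of_rule {a : Multifraction M} (h : a.Irreducible) {i : ℕ} {x : M}
    {l : List (Bool × M)} (hr : Rule i x a.1 l) : x = 1 := by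
  by_contra hx
  exact h ⟨⟨l, hr.isChain a.2⟩, i, x, hx, hr⟩

/-- The common multiple `c` provides the lcm of `x` and `a₁` that the rule requires; the preceding
entry `e` puts the rule in the case `i ≥ 2`. -/
theorem Irreducible.eq_one_of_commonMultiple (hM : IsGcdMonoid M) {a : Multifraction M}
    (h : a.Irreducible) {u v : List (Bool × M)} {e : Bool × M} {s s' : Bool} {a₁ a₂ x c : M}
    (ha : a.1 = u ++ e :: (s, a₁) :: (s', a₂) :: v) (hx : SignDvd s x a₂)
    (hc : SignDvd s x c) (hc' : SignDvd s a₁ c) : x = 1 := by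
  have hch : (e :: (s, a₁) :: (s', a₂) :: v).IsChain fun e f => e.1 ≠ f.1 := by
    have := a.2
    rw [ha] at this
    exact this.right_of_append
  simp only [List.isChain_cons_cons] at hch
  obtain ⟨h1, h2, -⟩ := hch
  obtain ⟨s₀, a₀⟩ := e
  cases s
  · obtain rfl : s' = true := by simpa using h2
    obtain rfl : s₀ = true := by simpa using h1
    simp only [SignDvd, Bool.false_eq_true, if_false] at hx hc hc'
    obtain ⟨m, hm⟩ := hM.exists_rightLcm hc hc'
    obtain ⟨b₁, hb₁⟩ := hm.1
    obtain ⟨x', rfl⟩ := hm.2.1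
    obtain ⟨b₂, hb₂⟩ := hx
    have := Rule.neg u v a₀ a₁ a₂ b₁ b₂ x x' hm hb₁ hb₂
    rw [← ha] at this
    exact h.eq_one_of_rule this
  · obtain rfl : s' = false := by simpa using h2
    obtain rfl : s₀ = false := by simpa using h1
    simp only [SignDvd, if_true] at hx hc hc'
    obtain ⟨m, hm⟩ := hM.exists_leftLcm hc hc'
    obtain ⟨b₁, hb₁⟩ := hm.1
    obtain ⟨x', rfl⟩ := hm.2.1
    obtain ⟨b₂, hb₂⟩ := hx
    have := Rule.pos u v a₀ a₁ a₂ b₁ b₂ x x' hm hb₁ hb₂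
    rw [← ha] at this
    exact h.eq_one_of_rule this

/-- If nothing precedes, this is a rule of index 1; otherwise `a₁` itself serves as common multiple.
-/
theorem Irreducible.eq_one_of_signDvd (hM : IsGcdMonoid M) {a : Multifraction M}
    (h : a.Irreducible) {u v : List (Bool × M)} {s s' : Bool} {a₁ a₂ x : M}
    (ha : a.1 = u ++ (s, a₁) :: (s', a₂) :: v) (hx : SignDvd s x a₁) (hx' : SignDvd s x a₂) :
    x = 1 := by
  rcases List.eq_nil_or_concat u with rfl | ⟨u, e, rfl⟩
  · have hch : s ≠ s' := by
      have := a.2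
      rw [ha] at this
      exact (List.isChain_cons_cons.1 this).1
    rw [List.nil_append] at ha
    cases s
    · obtain rfl : s' = true := by simpa using hch
      simp only [SignDvd, Bool.false_eq_true, if_false] at hx hx'
      obtain ⟨b₁, hb₁⟩ := hx
      obtain ⟨b₂, hb₂⟩ := hx'
      have := Rule.neg_one v a₁ a₂ b₁ b₂ x hb₁ hb₂
      rw [← ha] at this
      exact h.eq_one_of_rule this
    · obtain rfl : s' = false := by simpa using hch
      simp only [SignDvd, if_true] at hx hx'
      obtain ⟨b₁, hb₁⟩ := hx
      obtain ⟨b₂, hb₂⟩ := hx'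
      have := Rule.pos_one v a₁ a₂ b₁ b₂ x hb₁ hb₂
      rw [← ha] at this
      exact h.eq_one_of_rule this
  · refine h.eq_one_of_commonMultiple hM (u := u) (e := e) (by simpa using ha) hx' hx ?_
    cases s
    · exact ⟨1, mul_one _⟩
    · exact ⟨1, one_mul _⟩

/-- The whole of `a₂` could be pushed through a trivial entry that has a predecessor. -/
theorem Irreducible.eq_one_of_eq_one (hM : IsGcdMonoid M) {a : Multifraction M}
    (h : a.Irreducible) {u v : List (Bool × M)} {e : Bool × M} {s s' : Bool} {a₂ : M}
    (ha : a.1 = u ++ e :: (s, 1) :: (s', a₂) :: v) : a₂ = 1 := by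
  refine h.eq_one_of_commonMultiple hM ha (c := a₂) ?_ ?_ ?_ <;> cases s
  · exact ⟨1, mul_one _⟩
  · exact ⟨1, one_mul _⟩
  · exact ⟨1, mul_one _⟩
  · exact ⟨1, one_mul _⟩
  · exact ⟨a₂, one_mul _⟩
  · exact ⟨a₂, mul_one _⟩

end Multifraction

end Reduction

/-! ### Closed paths in lists of arrows -/

section Runs

variable {P : Type*}

/-- A list of pairs that is a path from `s` to `t`. -/
def IsPath : List (P × P) → P → P → Prop
  | [], s, t => s = t
  | e :: l, s, t => e.1 = s ∧ IsPath l e.2 t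

theorem IsPath.append {l l' : List (P × P)} {s t r : P} (h : IsPath l s t) (h' : IsPath l' t r) :
    IsPath (l ++ l') s r := by
  induction l generalizing s with
  | nil => cases h; exact h'
  | cons e l ih => exact ⟨h.1, ih h.2⟩

/-- If the product of a nonempty list of arrows, each of which is the composition of a path, is
trivial in the free group, then the concatenation of these paths contains a closed path. -/
theorem exists_closed_path_of_blocks (L : List ((P × P) × List (P × P)))
    (h : ∀ b ∈ L, b.2 ≠ [] ∧ IsPath b.2 b.1.1 b.1.2) (hne : L ≠ [])
    (hprod : ((L.map Prod.fst).map arrow).prod = 1) :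
    ∃ B s, B ≠ [] ∧ IsPath B s s ∧ B <:+: (L.map Prod.snd).flatten := by
  obtain ⟨m, hm⟩ : ∃ m, L.length = m := ⟨_, rfl⟩
  induction m using Nat.strong_induction_on generalizing L with
  | _ m ih =>
  -- A nonempty reduced word is not `1`, so either some block is closed or two neighbouring blocks
  -- compose. In the second case merging them leaves fewer blocks.
  have hnr : ¬ FreeGroup.IsReduced (spell (L.map Prod.fst)) := fun hr =>
    hne (List.map_eq_nil_iff.1 (eq_of_prod_arrow_eq hr (by simp [spell]) (w := [])
      (by rw [hprod]; rfl)))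
  rw [isReduced_spell_iff] at hnr
  by_cases h1 : ∃ b ∈ L, b.1.1 = b.1.2
  · obtain ⟨b, hb, hb1⟩ := h1
    refine ⟨b.2, b.1.1, (h b hb).1, ?_, ?_⟩
    · have := (h b hb).2
      rwa [← hb1] at this
    · exact List.infix_of_mem_flatten (List.mem_map_of_mem hb)
  have h2 : ¬ (L.map Prod.fst).IsChain fun e f => e.2 ≠ f.1 := by
    refine fun hc => hnr ⟨?_, hc⟩
    intro e he
    obtain ⟨b, hb, rfl⟩ := List.mem_map.1 he
    exact fun hb1 => h1 ⟨b, hb, hb1⟩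
  rw [List.isChain_map, List.isChain_iff_forall_rel_of_append_cons_cons] at h2
  push Not at h2
  obtain ⟨b, c, u, v, rfl, hbc⟩ := h2
  have hb := h b (by simp)
  have hc := h c (by simp)
  have key := ih _ (by rw [← hm]; simp) (u ++ ((b.1.1, c.1.2), b.2 ++ c.2) :: v) ?_ (by simp) ?_ rfl
  · simpa using key
  · intro d hd
    simp only [List.mem_append, List.mem_cons] at hd
    rcases hd with hd | rfl | hd
    · exact h d (by simp [hd])
    · refine ⟨by simp [hb.1], hb.2.append ?_⟩
      rw [hbc]
      exact hc.2
    · exact h d (by simp [hd])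
  · simpa [arrow, hbc, mul_assoc] using hprod

theorem exists_closed_path (L : List (P × P)) (hne : L ≠ []) (hprod : (L.map arrow).prod = 1) :
    ∃ B s, B ≠ [] ∧ IsPath B s s ∧ B <:+: L := by
  have hfl : (L.map fun e => [e]).flatten = L := by
    induction L with
    | nil => rfl
    | cons e L ih => simp [← List.flatMap_def]
  have := exists_closed_path_of_blocks (L.map fun e => (e, [e])) (by
    intro b hb
    obtain ⟨e, -, rfl⟩ := List.mem_map.1 hb
    exact ⟨by simp, rfl, rfl⟩) (by simpa) (by simpa [Function.comp_def] using hprod)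
  simpa only [List.map_map, Function.comp_def, hfl] using this

variable {α : Type*} {R : α → α → Prop}

theorem exists_of_cons_prefix_flatten {L : List (List α)} (hne : ∀ l ∈ L, l ≠ []) {f : α}
    {l : List α} (h : f :: l <+: L.flatten) :
    ∃ l₂ v, L = (f :: l₂) :: v ∧ l <+: l₂ ++ v.flatten := by
  cases L with
  | nil => simp at h
  | cons k L =>
    cases k with
    | nil => exact absurd rfl (hne [] (by simp))
    | cons a k =>
      rw [List.flatten_cons, List.cons_append, List.cons_prefix_cons] at h
      obtain ⟨rfl, h⟩ := h
      exact ⟨k, L, rfl, h⟩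

/-- No two neighbours inside a member of `L` are related, so a related pair straddles a boundary. -/
theorem exists_of_pair_infix_flatten {L : List (List α)} (hne : ∀ l ∈ L, l ≠ [])
    (hL : ∀ l ∈ L, l.IsChain fun a b => ¬ R a b) {e f : α} (hef : R e f)
    (h : [e, f] <:+: L.flatten) :
    ∃ u l₁ l₂ v, L = u ++ (l₁ ++ [e]) :: (f :: l₂) :: v := by
  induction L with
  | nil => simp at h
  | cons l L ih =>
    rw [List.flatten_cons, List.infix_append_iff_ne_nil] at h
    rcases h with h | h | ⟨t₁, t₂, h0, h1, h, h3, h4⟩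
    · have := (hL l (by simp)).infix h
      simp [hef] at this
    · obtain ⟨u, l₁, l₂, v, rfl⟩ := ih (fun l hl => hne l (by simp [hl]))
        (fun l hl => hL l (by simp [hl])) h
      exact ⟨l :: u, l₁, l₂, v, rfl⟩
    · obtain ⟨rfl, rfl⟩ : t₁ = [e] ∧ t₂ = [f] := by
        rcases t₁ with _ | ⟨a, _ | ⟨b, t₁⟩⟩ <;> simp_all
      obtain ⟨l₁, rfl⟩ := h3
      obtain ⟨l₂, v, rfl, -⟩ := exists_of_cons_prefix_flatten (fun l hl => hne l (by simp [hl])) h4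
      exact ⟨[], l₁, l₂, v, rfl⟩

/-- Both pairs straddle a boundary, which leaves `f` alone in its list. -/
theorem exists_of_triple_infix_flatten {L : List (List α)} (hne : ∀ l ∈ L, l ≠ [])
    (hL : ∀ l ∈ L, l.IsChain fun a b => ¬ R a b) {e f g : α} (hef : R e f) (hfg : R f g)
    (h : [e, f, g] <:+: L.flatten) :
    ∃ u l₁ l₂ v, L = u ++ (l₁ ++ [e]) :: [f] :: (g :: l₂) :: v := by
  induction L with
  | nil => simp at h
  | cons l L ih =>
    rw [List.flatten_cons, List.infix_append_iff_ne_nil] at h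
    rcases h with h | h | ⟨t₁, t₂, h0, h1, h, h3, h4⟩
    · have := (hL l (by simp)).infix h
      simp [hef] at this
    · obtain ⟨u, l₁, l₂, v, rfl⟩ := ih (fun l hl => hne l (by simp [hl]))
        (fun l hl => hL l (by simp [hl])) h
      exact ⟨l :: u, l₁, l₂, v, rfl⟩
    · rcases t₁ with _ | ⟨a, _ | ⟨b, t₁⟩⟩
      · simp at h0
      · obtain ⟨rfl, rfl⟩ : e = a ∧ [f, g] = t₂ := by simpa using h
        obtain ⟨l₁, rfl⟩ := h3
        obtain ⟨l₂, v, rfl, h5⟩ :=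
          exists_of_cons_prefix_flatten (fun l hl => hne l (by simp [hl])) h4
        cases l₂ with
        | nil =>
          rw [List.nil_append] at h5
          obtain ⟨l₂, v, rfl, -⟩ :=
            exists_of_cons_prefix_flatten (fun l hl => hne l (by simp [hl])) h5
          exact ⟨[], l₁, l₂, v, rfl⟩
        | cons b l₂ =>
          rw [List.cons_append, List.cons_prefix_cons] at h5
          obtain ⟨rfl, -⟩ := h5
          have := hL (f :: g :: l₂) (by simp)
          simp [hfg] at this
      · obtain ⟨rfl, rfl⟩ : e = a ∧ f = b := by simp_all
        have := (hL l (by simp)).infix h3.isInfix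
        simp [hef] at this

theorem length_le_one_of_isChain {l : List α} (h : l.IsChain R) (h' : l.IsChain fun a b => ¬ R a b) :
    l.length ≤ 1 := by
  rcases l with _ | ⟨a, _ | ⟨b, l⟩⟩
  · simp
  · simp
  · exact absurd (List.isChain_cons_cons.1 h).1 (List.isChain_cons_cons.1 h').1

theorem length_le_of_prefix_flatten {L : List (List α)}
    (hL : ∀ l ∈ L, l.IsChain fun a b => ¬ R a b) {B : List α} (hB : B.IsChain R)
    (h : B <+: L.flatten) : B.length ≤ L.length := by
  induction L generalizing B with
  | nil => simpa using h
  | cons l L ih =>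
    rw [List.flatten_cons] at h
    replace h : B <+: l ∨ ∃ B', B = l ++ B' ∧ B' <+: L.flatten := by
      obtain ⟨t, ht⟩ := h
      rcases List.append_eq_append_iff.1 ht with ⟨c, h1, -⟩ | ⟨c, h1, h2⟩
      · exact .inl ⟨c, h1.symm⟩
      · exact .inr ⟨c, h1, t, h2.symm⟩
    rcases h with h | ⟨B', rfl, h⟩
    · have := length_le_one_of_isChain hB ((hL l (by simp)).infix h.isInfix)
      simp only [List.length_cons]
      omega
    · have h1 := length_le_one_of_isChain hB.left_of_append (hL l (by simp))
      have h2 := ih (fun l hl => hL l (by simp [hl])) hB.right_of_append h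
      simp only [List.length_cons, List.length_append]
      omega

/-- A chain for `R` takes at most one element from each list. -/
theorem length_le_of_infix_flatten {L : List (List α)}
    (hL : ∀ l ∈ L, l.IsChain fun a b => ¬ R a b) {B : List α} (hB : B.IsChain R)
    (h : B <:+: L.flatten) : B.length ≤ L.length := by
  induction L generalizing B with
  | nil => simpa using h
  | cons l L ih =>
    rw [List.flatten_cons, List.infix_append_iff] at h
    have hL' : ∀ l ∈ L, l.IsChain fun a b => ¬ R a b := fun l hl => hL l (by simp [hl])
    simp only [List.length_cons]
    rcases h with h | h | ⟨t₁, t₂, rfl, h3, h4⟩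
    · have := length_le_one_of_isChain hB ((hL l (by simp)).infix h)
      omega
    · have := ih hL' hB h
      omega
    · have h1 := length_le_one_of_isChain hB.left_of_append ((hL l (by simp)).infix h3.isInfix)
      have h2 := length_le_of_prefix_flatten hL' hB.right_of_append h4
      rw [List.length_append]
      omega

theorem IsPath.isChain {l : List (P × P)} {s t : P} (h : IsPath l s t) :
    l.IsChain fun e f => e.2 = f.1 := by
  induction l generalizing s with
  | nil => exact .nil
  | cons e l ih =>
    cases l with
    | nil => exact .singleton _
    | cons f l => exact List.isChain_cons_cons.2 ⟨h.2.1.symm, ih h.2⟩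

/-- The vertices of a path with target `t`. -/
def vertex (l : List (P × P)) (t : P) (k : ℕ) : P := l[k]?.elim t Prod.fst

theorem vertex_length (l : List (P × P)) (t : P) : vertex l t l.length = t := by
  simp [vertex]

theorem IsPath.vertex_zero {l : List (P × P)} {s t : P} (h : IsPath l s t) : vertex l t 0 = s := by
  cases l with
  | nil => exact h.symm
  | cons e l => exact h.1

theorem IsPath.getElem {l : List (P × P)} {s t : P} (h : IsPath l s t) {k : ℕ}
    (hk : k < l.length) : l[k] = (vertex l t k, vertex l t (k + 1)) := by
  induction l generalizing s k with
  | nil => simp at hk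
  | cons e l ih =>
    cases k with
    | zero => exact Prod.ext rfl h.2.vertex_zero.symm
    | succ k => exact ih h.2 (by simpa using hk)

end Runs

/-! ### From irreducible unital multifractions to irreducible loops -/

section Loops

variable {P : Type*} [PartialOrder P]

/-- The peak `v` between `p` and `n` resists division: no element other than `v` between `n` and
`v` has a common lower bound with `p`. -/
def StrongPeak (p v n : P) : Prop :=
  p < v ∧ n < v ∧ ∀ w q, n ≤ w → w ≤ v → q ≤ w → q ≤ p → w = v

/-- The dual of `StrongPeak`. -/
def StrongValley (p v n : P) : Prop :=
  v < p ∧ v < n ∧ ∀ w q, v ≤ w → w ≤ n → w ≤ q → p ≤ q → w = v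

/-- The peak `v` is the join of `p` and `n` among the elements below `v`. -/
def WeakPeak (p v n : P) : Prop :=
  p < v ∧ n < v ∧ ∀ w, p ≤ w → n ≤ w → w ≤ v → w = v

/-- The dual of `WeakPeak`. -/
def WeakValley (p v n : P) : Prop :=
  v < p ∧ v < n ∧ ∀ w, w ≤ p → w ≤ n → v ≤ w → w = v

/-- An irreducible closed zigzag of length `l`. -/
structure IsIrredLoop (l : ℕ) (v : ℕ → P) : Prop where
  two_le : 2 ≤ l
  closed : v l = v 0
  weak : WeakPeak (v 0) (v 1) (v 2) ∨ WeakValley (v 0) (v 1) (v 2)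
  strong : ∀ k, k + 3 ≤ l → StrongPeak (v (k + 1)) (v (k + 2)) (v (k + 3)) ∨
    StrongValley (v (k + 1)) (v (k + 2)) (v (k + 3))

/-- The normal word of an element of the interval monoid. -/
noncomputable def nf (a : IntervalMonoid P) : List (P × P) := (exists_normal a).choose

theorem normal_nf (a : IntervalMonoid P) : Normal (nf a) := (exists_normal a).choose_spec.1

@[simp] theorem wprod_nf (a : IntervalMonoid P) : wprod (nf a) = a := (exists_normal a).choose_spec.2

/-- The list of arrows attached to a signed element. -/
noncomputable def arrows (e : Bool × IntervalMonoid P) : List (P × P) :=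
  if e.1 then nf e.2 else ((nf e.2).map Prod.swap).reverse

theorem arrows_eq_nil_iff (e : Bool × IntervalMonoid P) : arrows e = [] ↔ e.2 = 1 := by
  have h : nf e.2 = [] ↔ e.2 = 1 := by
    constructor
    · intro h
      rw [← wprod_nf e.2, h, wprod_nil]
    · intro h
      exact (normal_nf _).eq normal_nil (by simpa using h)
  rw [← h, arrows]
  split <;> simp

theorem ne_of_mem_arrows {e : Bool × IntervalMonoid P} {f : P × P} (hf : f ∈ arrows e) :
    f.1 ≠ f.2 := by
  have h := (normal_nf e.2).1
  rw [arrows] at hf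
  split at hf
  · exact (h f hf).ne
  · rw [List.mem_reverse, List.mem_map] at hf
    obtain ⟨g, hg, rfl⟩ := hf
    exact (h g hg).ne'

theorem isChain_arrows (e : Bool × IntervalMonoid P) :
    (arrows e).IsChain fun e f => ¬ e.2 = f.1 := by
  have h := (normal_nf e.2).2
  rw [arrows]
  split
  · exact h
  · rw [List.isChain_reverse, List.isChain_map]
    exact h.imp fun a b hab => Ne.symm hab

theorem prod_arrows (e : Bool × IntervalMonoid P) :
    ((arrows e).map arrow).prod = if e.1 then toFree P e.2 else (toFree P e.2)⁻¹ := by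
  have h : toFree P e.2 = ((nf e.2).map arrow).prod := by
    rw [← toFree_wprod (normal_nf _), wprod_nf]
  rw [arrows]
  split
  · exact h.symm
  · rw [h, List.prod_inv_reverse, List.map_reverse, List.map_map, List.map_map]
    congr 3

theorem prod_flatten_arrows (l : List (Bool × IntervalMonoid P)) :
    (((l.map arrows).flatten).map arrow).prod = envLift (toFree P) (evalList l) := by
  induction l with
  | nil => simp [evalList]
  | cons e l ih =>
    have h : evalList (e :: l) =
        (if e.1 then can _ e.2 else (can _ e.2)⁻¹) * evalList l := by simp [evalList]
    rw [List.map_cons, List.flatten_cons, List.map_append, List.prod_append, ih, prod_arrows, h,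
      map_mul]
    congr 1
    split <;> simp

/-- A negative entry is read backwards, so its last arrow is its first letter. In both cases the
divisor lies on the side given by `SignDvd s`. -/
theorem arrows_eq_append_singleton {s : Bool} {a : IntervalMonoid P} {l : List (P × P)} {p v : P}
    (h : arrows (s, a) = l ++ [(p, v)]) :
    if s then p < v ∧ ∀ w (hw : w ≤ v), p ≤ w → RightDvd (ivl w v hw) a
    else v < p ∧ ∀ w (hw : v ≤ w), w ≤ p → LeftDvd (ivl v w hw) a := by
  cases s
  · simp only [arrows, Bool.false_eq_true, if_false, List.reverse_eq_append_iff,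
      List.reverse_singleton, List.singleton_append, List.map_eq_cons_iff] at h ⊢
    obtain ⟨⟨v', p'⟩, l', h1, h2, -⟩ := h
    obtain ⟨rfl, rfl⟩ : p' = p ∧ v' = v := by simpa using h2
    have hn := normal_nf a
    rw [h1] at hn
    have hlt : v' < p' := hn.head_lt
    refine ⟨hlt, fun w hw hw' => ?_⟩
    rw [← wprod_nf a, h1, wprod_cons, letter_of_le hlt.le]
    exact (ivl_leftDvd_ivl _ hw').mul_right _
  · simp only [arrows, if_true] at h ⊢
    have hlt : p < v := (normal_nf a).1 (p, v) (by simp [h])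
    refine ⟨hlt, fun w hw hw' => ⟨wprod l * ivl p w hw', ?_⟩⟩
    rw [← wprod_nf a, h, wprod_append, wprod_cons, letter_of_le hlt.le, mul_assoc, ivl_mul_ivl,
      wprod_nil, mul_one]

/-- Here the divisor lies on the side relevant for the preceding entry, whose sign is opposite. -/
theorem arrows_eq_cons {s : Bool} {a : IntervalMonoid P} {l : List (P × P)} {v n : P}
    (h : arrows (s, a) = (v, n) :: l) :
    if s then v < n ∧ ∀ w (hw : v ≤ w), w ≤ n → LeftDvd (ivl v w hw) a
    else n < v ∧ ∀ w (hw : w ≤ v), n ≤ w → RightDvd (ivl w v hw) a := by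
  cases s
  · simp only [arrows, Bool.false_eq_true, if_false, List.reverse_eq_cons_iff,
      List.map_eq_append_iff] at h ⊢
    obtain ⟨l₁, l₂, h1, -, h2⟩ := h
    obtain ⟨⟨n', v'⟩, rfl, h3⟩ := List.map_eq_singleton_iff.1 h2
    obtain ⟨rfl, rfl⟩ : v' = v ∧ n' = n := by simpa using h3
    have hlt : n' < v' := (normal_nf a).1 (n', v') (by simp [h1])
    refine ⟨hlt, fun w hw hw' => ⟨wprod l₁ * ivl n' w hw', ?_⟩⟩
    rw [← wprod_nf a, h1, wprod_append, wprod_cons, letter_of_le hlt.le, mul_assoc, ivl_mul_ivl,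
      wprod_nil, mul_one]
  · simp only [arrows, if_true] at h ⊢
    have hlt : v < n := (normal_nf a).1 (v, n) (by simp [h])
    refine ⟨hlt, fun w hw hw' => ?_⟩
    rw [← wprod_nf a, h, wprod_cons, letter_of_le hlt.le]
    exact (ivl_leftDvd_ivl _ hw').mul_right _

theorem eq_ivl_of_arrows_eq_singleton {s : Bool} {a : IntervalMonoid P} {p v : P}
    (h : arrows (s, a) = [(p, v)]) :
    if s then ∃ hpv : p ≤ v, a = ivl p v hpv else ∃ hvp : v ≤ p, a = ivl v p hvp := by
  cases s
  · simp only [arrows, Bool.false_eq_true, if_false, List.reverse_eq_cons_iff, List.reverse_nil,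
      List.nil_append, List.map_eq_singleton_iff] at h ⊢
    obtain ⟨⟨v', p'⟩, h1, h2⟩ := h
    obtain ⟨rfl, rfl⟩ : p' = p ∧ v' = v := by simpa using h2
    have hlt : v' < p' := (normal_nf a).1 (v', p') (by simp [h1])
    refine ⟨hlt.le, ?_⟩
    rw [← wprod_nf a, h1, wprod_cons, letter_of_le hlt.le, wprod_nil, mul_one]
  · simp only [arrows, if_true] at h ⊢
    have hlt : p < v := (normal_nf a).1 (p, v) (by simp [h])
    refine ⟨hlt.le, ?_⟩
    rw [← wprod_nf a, h, wprod_cons, letter_of_le hlt.le, wprod_nil, mul_one]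

namespace Multifraction

theorem sign_ne {M : Type*} {a : Multifraction M} {u v : List (Bool × M)} {e f : Bool × M}
    (ha : a.1 = u ++ e :: f :: v) : e.1 ≠ f.1 := by
  have := a.2
  rw [ha] at this
  exact (List.isChain_cons_cons.1 this.right_of_append).1

/-- A vertex `w` violating the condition gives an interval between `w` and `v` that divides both
entries and could be cancelled. -/
theorem Irreducible.weak (hM : IsGcdMonoid (IntervalMonoid P))
    {a : Multifraction (IntervalMonoid P)} (h : a.Irreducible)
    {u l : List (Bool × IntervalMonoid P)} {e f : Bool × IntervalMonoid P}
    (ha : a.1 = u ++ e :: f :: l) {l₁ l₂ : List (P × P)} {p v n : P}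
    (he : arrows e = l₁ ++ [(p, v)]) (hf : arrows f = (v, n) :: l₂) :
    WeakPeak p v n ∨ WeakValley p v n := by
  have hs := sign_ne ha
  obtain ⟨s, b⟩ := e
  obtain ⟨s', c⟩ := f
  have he := arrows_eq_append_singleton he
  have hf := arrows_eq_cons hf
  cases s
  · obtain rfl : s' = true := by simpa using hs
    simp only [Bool.false_eq_true, if_false, if_true] at he hf
    refine .inr ⟨he.1, hf.1, fun w h1 h2 h3 => ?_⟩
    exact ((ivl_eq_one_iff h3).1 (h.eq_one_of_signDvd hM ha (he.2 w h3 h1) (hf.2 w h3 h2))).symm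
  · obtain rfl : s' = false := by simpa using hs
    simp only [Bool.false_eq_true, if_false, if_true] at he hf
    refine .inl ⟨he.1, hf.1, fun w h1 h2 h3 => ?_⟩
    exact (ivl_eq_one_iff h3).1 (h.eq_one_of_signDvd hM ha (he.2 w h3 h1) (hf.2 w h3 h2))

/-- As `e` is a single interval with a predecessor `d`, it suffices for a rule to apply that the
intervals joining `v` to `w` and to `p` have a common multiple; the interval joining `v` to `q` is
one. -/
theorem Irreducible.strong (hM : IsGcdMonoid (IntervalMonoid P))
    {a : Multifraction (IntervalMonoid P)} (h : a.Irreducible)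
    {u l : List (Bool × IntervalMonoid P)} {d e f : Bool × IntervalMonoid P}
    (ha : a.1 = u ++ d :: e :: f :: l) {l₂ : List (P × P)} {p v n : P}
    (he : arrows e = [(p, v)]) (hf : arrows f = (v, n) :: l₂) :
    StrongPeak p v n ∨ StrongValley p v n := by
  have hs := sign_ne (u := u ++ [d]) (v := l) (e := e) (f := f) (by simpa using ha)
  obtain ⟨s, b⟩ := e
  obtain ⟨s', c⟩ := f
  have he' := arrows_eq_append_singleton (l := []) he
  have he := eq_ivl_of_arrows_eq_singleton he
  have hf := arrows_eq_cons hf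
  cases s
  · obtain rfl : s' = true := by simpa using hs
    simp only [Bool.false_eq_true, if_false, if_true] at he hf he'
    obtain ⟨hvp, rfl⟩ := he
    refine .inr ⟨he'.1, hf.1, fun w q h1 h2 h3 h4 => ?_⟩
    exact ((ivl_eq_one_iff h1).1 (h.eq_one_of_commonMultiple hM ha
      (c := ivl v q (h1.trans h3)) (hf.2 w h1 h2) (ivl_leftDvd_ivl _ h3)
      (ivl_leftDvd_ivl _ h4))).symm
  · obtain rfl : s' = false := by simpa using hs
    simp only [Bool.false_eq_true, if_false, if_true] at he hf he'
    obtain ⟨hpv, rfl⟩ := he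
    refine .inl ⟨he'.1, hf.1, fun w q h1 h2 h3 h4 => ?_⟩
    exact (ivl_eq_one_iff h2).1 (h.eq_one_of_commonMultiple hM ha
      (c := ivl q v (h3.trans h2)) (hf.2 w h2 h1) ⟨ivl q w h3, ivl_mul_ivl _ _⟩
      ⟨ivl q p h4, ivl_mul_ivl _ _⟩)

theorem exists_split_of_isChain {M : Type*} [Monoid M] {l : List (Bool × M)}
    (h : l.IsChain fun e f => e.2 = 1 → f.2 = 1) :
    ∃ u v, l = u ++ v ∧ (∀ e ∈ u, e.2 ≠ 1) ∧ ∀ e ∈ v, e.2 = 1 := by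
  induction l with
  | nil => exact ⟨[], [], rfl, by simp, by simp⟩
  | cons e l ih =>
    obtain ⟨u, v, rfl, hu, hv⟩ := ih h.of_cons
    by_cases he : e.2 = 1
    · cases u with
      | nil => exact ⟨[], e :: v, rfl, by simp, by simpa [he] using hv⟩
      | cons f u => exact absurd ((List.isChain_cons_cons.1 h).1 he) (hu f (by simp))
    · exact ⟨e :: u, v, rfl, by simpa [he] using hu, hv⟩

/-- In an irreducible multifraction, the nontrivial entries are consecutive. -/
theorem Irreducible.exists_split {M : Type*} [Monoid M] (hM : IsGcdMonoid M)
    {a : Multifraction M} (h : a.Irreducible) :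
    ∃ t u v, a.1 = t ++ u ++ v ∧ (∀ e ∈ t, e.2 = 1) ∧ (∀ e ∈ u, e.2 ≠ 1) ∧ ∀ e ∈ v, e.2 = 1 := by
  obtain ⟨l, hl⟩ : ∃ l, a.1 = l := ⟨_, rfl⟩
  cases l with
  | nil => exact ⟨[], [], [], hl, by simp, by simp, by simp⟩
  | cons e l =>
    obtain ⟨u, v, rfl, hu, hv⟩ := exists_split_of_isChain (l := l) (by
      rw [List.isChain_iff_forall_rel_of_append_cons_cons]
      rintro ⟨s, b⟩ ⟨s', c⟩ l₁ l₂ rfl rfl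
      rcases List.eq_nil_or_concat l₁ with rfl | ⟨l₁, d, rfl⟩
      · exact h.eq_one_of_eq_one hM (u := []) hl
      · exact h.eq_one_of_eq_one hM (u := e :: l₁) (e := d) (v := l₂) (by simpa using hl))
    by_cases he : e.2 = 1
    · exact ⟨[e], u, v, by simpa using hl, by simpa using he, hu, hv⟩
    · exact ⟨[], e :: u, v, by simpa using hl, by simp, by simpa [he] using hu, hv⟩

theorem flatten_map_arrows_eq_nil {l : List (Bool × IntervalMonoid P)} (h : ∀ e ∈ l, e.2 = 1) :
    (l.map arrows).flatten = [] := by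
  rw [List.flatten_eq_nil_iff]
  intro k hk
  obtain ⟨e, he, rfl⟩ := List.mem_map.1 hk
  exact (arrows_eq_nil_iff e).2 (h e he)

/-- A nontrivial irreducible unital multifraction gives rise to an irreducible loop. -/
theorem Irreducible.exists_loop (hM : IsGcdMonoid (IntervalMonoid P))
    {a : Multifraction (IntervalMonoid P)} (h : a.Irreducible) (hu : a.Unital)
    (ht : ¬ a.Trivial) : ∃ l v, l ≤ a.depth ∧ IsIrredLoop (P := P) l v := by
  obtain ⟨t, u, v, ha, h1, h2, h3⟩ := h.exists_split hM
  have hflat : (a.1.map arrows).flatten = (u.map arrows).flatten := by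
    rw [ha, List.map_append, List.map_append, List.flatten_append, List.flatten_append,
      flatten_map_arrows_eq_nil h1, flatten_map_arrows_eq_nil h3, List.nil_append, List.append_nil]
  have hprod : (((u.map arrows).flatten).map arrow).prod = 1 := by
    rw [← hflat, prod_flatten_arrows]
    have : evalList a.1 = 1 := hu
    rw [this, map_one]
  have hne : ∀ l ∈ u.map arrows, l ≠ [] := by
    intro l hl
    obtain ⟨e, he, rfl⟩ := List.mem_map.1 hl
    exact fun h => h2 e he ((arrows_eq_nil_iff e).1 h)
  have hch : ∀ l ∈ u.map arrows, l.IsChain fun e f => ¬ e.2 = f.1 := by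
    intro l hl
    obtain ⟨e, he, rfl⟩ := List.mem_map.1 hl
    exact isChain_arrows e
  have hune : u ≠ [] := by
    rintro rfl
    refine ht fun e he => ?_
    rw [ha] at he
    simp only [List.append_nil, List.mem_append] at he
    exact he.elim (h1 e) (h3 e)
  -- Trivial entries contribute no arrows, so the path lives in the run `u` of nontrivial entries.
  obtain ⟨B, s, hB, hpath, hinf⟩ := exists_closed_path (u.map arrows).flatten (by
    obtain ⟨e, u, rfl⟩ := List.exists_cons_of_ne_nil hune
    have := hne (arrows e) (by simp)
    simp [this]) hprod
  have hget : ∀ k (hk : k < B.length), B[k] = (vertex B s k, vertex B s (k + 1)) :=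
    fun k hk => hpath.getElem hk
  have hdrop2 : ∀ k, k + 2 ≤ B.length → [(vertex B s k, vertex B s (k + 1)),
      (vertex B s (k + 1), vertex B s (k + 2))] <:+: (u.map arrows).flatten := by
    intro k hk
    refine List.IsInfix.trans ⟨B.take k, B.drop (k + 2), ?_⟩ hinf
    rw [← hget k (by omega), ← hget (k + 1) (by omega)]
    conv_rhs => rw [← List.take_append_drop k B, List.drop_eq_getElem_cons (by omega),
      List.drop_eq_getElem_cons (by omega)]
    simp
  have hdrop3 : ∀ k, k + 3 ≤ B.length → [(vertex B s k, vertex B s (k + 1)),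
      (vertex B s (k + 1), vertex B s (k + 2)), (vertex B s (k + 2), vertex B s (k + 3))] <:+:
        (u.map arrows).flatten := by
    intro k hk
    refine List.IsInfix.trans ⟨B.take k, B.drop (k + 3), ?_⟩ hinf
    rw [← hget k (by omega), ← hget (k + 1) (by omega), ← hget (k + 2) (by omega)]
    conv_rhs => rw [← List.take_append_drop k B, List.drop_eq_getElem_cons (by omega),
      List.drop_eq_getElem_cons (by omega), List.drop_eq_getElem_cons (by omega)]
    simp
  have hlen2 : 2 ≤ B.length := by
    by_contra hlt
    have hpos : 0 < B.length := List.length_pos_iff.2 hB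
    have hl1 : B.length = 1 := by omega
    have hm : B[0] ∈ (u.map arrows).flatten := hinf.subset (List.getElem_mem _)
    obtain ⟨l, hl, hm⟩ := List.mem_flatten.1 hm
    obtain ⟨e, he, rfl⟩ := List.mem_map.1 hl
    have h5 := vertex_length B s
    rw [hl1] at h5
    have := ne_of_mem_arrows hm
    rw [hget 0 hpos, hpath.vertex_zero, Nat.zero_add, h5] at this
    exact this rfl
  refine ⟨B.length, vertex B s, ?_, hlen2, ?_, ?_, ?_⟩
  · have := length_le_of_infix_flatten hch hpath.isChain hinf
    rw [List.length_map] at this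
    simp only [depth, ha, List.length_append]
    omega
  · rw [vertex_length, hpath.vertex_zero]
  · obtain ⟨u', l₁, l₂, v', h5⟩ := exists_of_pair_infix_flatten hne hch rfl (hdrop2 0 hlen2)
    obtain ⟨u₁, x, rfl, -, h5⟩ := List.map_eq_append_iff.1 h5
    obtain ⟨e, x, rfl, he, h5⟩ := List.map_eq_cons_iff.1 h5
    obtain ⟨f, x, rfl, hf, -⟩ := List.map_eq_cons_iff.1 h5
    exact h.weak hM (u := t ++ u₁) (l := x ++ v) (by simpa using ha) he hf
  · intro k hk
    -- From the second turn on, the incoming arrow is a whole entry and has a predecessor; the first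
    -- turn lacks this and is only weak.
    obtain ⟨u', l₁, l₂, v', h5⟩ := exists_of_triple_infix_flatten hne hch rfl rfl (hdrop3 k hk)
    obtain ⟨u₁, x, rfl, -, h5⟩ := List.map_eq_append_iff.1 h5
    obtain ⟨d, x, rfl, -, h5⟩ := List.map_eq_cons_iff.1 h5
    obtain ⟨e, x, rfl, he, h5⟩ := List.map_eq_cons_iff.1 h5
    obtain ⟨f, x, rfl, hf, -⟩ := List.map_eq_cons_iff.1 h5
    exact h.strong hM (u := t ++ u₁) (d := d) (l := x ++ v) (by simpa using ha) he hf

end Multifraction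

end Loops

/-! ### Interval monoids of posets with a height function -/

section Height

variable {P : Type*} [PartialOrder P]

/-- The length on the interval monoid that is induced by a monotone function on `P`. -/
def ivlLength (ht : P → ℕ) (hht : StrictMono ht) (a : IntervalMonoid P) : ℕ :=
  (ivlLift (N := Multiplicative ℕ) (fun s t _ => .ofAdd (ht t - ht s)) (by simp) (by
    intro s t r h h'
    have h1 := hht.monotone h
    have h2 := hht.monotone h'
    rw [← ofAdd_add]
    congr 1
    omega) a).toAdd

theorem ivlLength_mul (ht : P → ℕ) (hht : StrictMono ht) (a b : IntervalMonoid P) :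
    ivlLength ht hht (a * b) = ivlLength ht hht a + ivlLength ht hht b := by
  simp [ivlLength]

theorem eq_one_of_ivlLength_eq_zero (ht : P → ℕ) (hht : StrictMono ht) (a : IntervalMonoid P)
    (h : ivlLength ht hht a = 0) : a = 1 := by
  induction a using ivl_induction with
  | h1 => rfl
  | h2 s t hst a ih =>
    rw [ivlLength_mul, Nat.add_eq_zero_iff] at h
    have h1 : ht t - ht s = 0 := h.1
    have h2 : s = t := hst.eq_or_lt.resolve_right fun hlt => by
      have := hht hlt
      omega
    subst h2
    rw [ivl_self, ih h.2, mul_one]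

theorem isGcdMonoid_intervalMonoid (ht : P → ℕ) (hht : StrictMono ht) (h : LocalMeets P)
    (h' : LocalMeets Pᵒᵈ) : IsGcdMonoid (IntervalMonoid P) where
  cancel := isCancelMul_intervalMonoid
  eq_one_of_isUnit := eq_one_of_isUnit_of_length (ivlLength ht hht) (ivlLength_mul ht hht)
    (eq_one_of_ivlLength_eq_zero ht hht)
  exists_leftGcd := exists_leftGcd h
  exists_rightGcd := exists_rightGcd h'

theorem isNoetherianMonoid_intervalMonoid (ht : P → ℕ) (hht : StrictMono ht) :
    IsNoetherianMonoid (IntervalMonoid P) :=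
  isNoetherianMonoid_of_length (ivlLength ht hht) (ivlLength_mul ht hht)
    (eq_one_of_ivlLength_eq_zero ht hht)

/-- Reduction is `p`-semi-convergent if there are no irreducible loops of length at most `p`. -/
theorem semiConvergentUpTo_of_no_loop (ht : P → ℕ) (hht : StrictMono ht) (h : LocalMeets P)
    (h' : LocalMeets Pᵒᵈ) (p : ℕ) (hp : ∀ l (v : ℕ → P), l ≤ p → ¬ IsIrredLoop l v) :
    SemiConvergentUpTo (IntervalMonoid P) p := by
  refine semiConvergentUpTo_of_trivial (ivlLength ht hht) (ivlLength_mul ht hht)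
    (eq_one_of_ivlLength_eq_zero ht hht) p fun a ha hu hi => ?_
  by_contra hne
  obtain ⟨l, v, hl, hv⟩ := hi.exists_loop (isGcdMonoid_intervalMonoid ht hht h h') hu hne
  exact hp l v (hl.trans ha) hv

end Height

/-! ### Strong turns as obstructions to the rules -/

section Criteria

variable {P : Type*} [PartialOrder P]

/-- A right divisor of `[r, t]` is some `[w, t]`. A common left multiple with `[s, t]` gives a
common lower bound of `w` and `s`, which forces `w = t`. -/
theorem StrongPeak.eq_one {s t r : P} (h : StrongPeak s t r) {x b c d : IntervalMonoid P}
    (h1 : b * x = d * ivl s t h.1.le) (h2 : c * x = ivl r t h.2.1.le) : x = 1 := by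
  obtain ⟨w, hw, hw', rfl⟩ := eq_ivl_of_rightDvd_ivl _ ⟨c, h2⟩
  rcases hw.eq_or_lt with rfl | hlt
  · exact ivl_self _ _
  · obtain ⟨q, hq, hq'⟩ := exists_le_of_mul_ivl_eq hlt h.1 h1
    exact absurd (h.2.2 w q hw' hw hq hq') hlt.ne

theorem StrongValley.eq_one {s t r : P} (h : StrongValley s t r) {x b c d : IntervalMonoid P}
    (h1 : x * b = ivl t s h.1.le * d) (h2 : x * c = ivl t r h.2.1.le) : x = 1 := by
  obtain ⟨w, hw, hw', rfl⟩ := eq_ivl_of_leftDvd_ivl _ ⟨c, h2⟩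
  rcases hw.eq_or_lt with rfl | hlt
  · exact ivl_self _ _
  · obtain ⟨q, hq, hq'⟩ := exists_le_of_ivl_mul_eq hlt h.1 h1
    exact absurd (h.2.2 w q hw hw' hq hq') hlt.ne'

end Criteria

/-! ### Order, parity and local meets in the poset -/

theorem localMeets_of_forall {P : Type*} [PartialOrder P]
    (h : ∀ s w w' t t' : P, s < w → s < w' → w < t → w < t' → w' < t → w' < t' → t ≠ t' → w = w') :
    LocalMeets P := by
  intro s t t' hst hst'
  by_cases h1 : t ≤ t'
  · exact ⟨t, hst, le_rfl, h1, fun v _ hv _ => hv⟩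
  by_cases h2 : t' ≤ t
  · exact ⟨t', hst', h2, le_rfl, fun v _ _ hv => hv⟩
  have key : ∀ v, v ≤ t → v ≤ t' → v < t ∧ v < t' := fun v hv hv' =>
    ⟨hv.lt_of_ne fun h => h1 (h ▸ hv'), hv'.lt_of_ne fun h => h2 (h ▸ hv)⟩
  by_cases h3 : ∃ w, s < w ∧ w ≤ t ∧ w ≤ t'
  · obtain ⟨w, hw, hwt, hwt'⟩ := h3
    refine ⟨w, hw.le, hwt, hwt', fun v hv hvt hvt' => ?_⟩
    rcases hv.eq_or_lt with rfl | hv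
    · exact hw.le
    · exact (h s v w t t' hv hw (key v hvt hvt').1 (key v hvt hvt').2 (key w hwt hwt').1
        (key w hwt hwt').2 fun h => h1 h.le).le
  · refine ⟨s, le_rfl, hst, hst', fun v hv hvt hvt' => ?_⟩
    rcases hv.eq_or_lt with rfl | hv
    · exact le_rfl
    · exact absurd ⟨v, hv, hvt, hvt'⟩ h3

namespace PC

variable {n : ℕ}

/-- Evenness of an index. -/
def Ev (i : ZMod n) : Prop := Even i.val

/-- An explicit description of the strict order. -/
def Below : PC n → PC n → Prop
  | x i, y j => i = j ∨ i = j + 1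
  | y j, z i => i = j ∨ i = j + 1
  | x i, z j => i = j ∨ i = j + 1 ∨ j = i + 1 ∨ (Ev i ∧ ¬ Ev j)
  | x i, center => Ev i
  | center, z j => ¬ Ev j
  | _, _ => False

theorem Step.below {a b : PC n} (h : Step n a b) : Below a b := by
  cases h <;> simp_all [Below, Ev]

theorem le_iff (a b : PC n) : a ≤ b ↔ a = b ∨ Below a b := by
  constructor
  · intro h
    induction (show Relation.ReflTransGen (Step n) a b from h) with
    | refl => exact .inl rfl
    | tail hab hbc ih =>
      rcases ih hab with rfl | h1
      · exact .inr hbc.below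
      · right
        cases hbc <;> cases a <;> simp_all [Below, Ev] <;> grind
  · have hs : ∀ {a b : PC n}, Step n a b → a ≤ b := fun h => Relation.ReflTransGen.single h
    have e1 : ∀ j : ZMod n, x (j + 1) ≤ y j := fun j => hs (by
      have h := Step.x_y_pred (j + 1)
      rwa [add_sub_cancel_right] at h)
    have e2 : ∀ j : ZMod n, y j ≤ z (j + 1) := fun j => hs (by
      have h := Step.y_pred_z (j + 1)
      rwa [add_sub_cancel_right] at h)
    rintro (rfl | h)
    · exact le_rfl
    · cases a <;> cases b <;> simp only [Below] at h
      · rcases h with rfl | rfl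
        · exact hs (.x_y _)
        · exact e1 _
      · rcases h with rfl | rfl | rfl | ⟨h, h'⟩
        · exact (hs (.x_y _)).trans (hs (.y_z _))
        · exact x_succ_le_z _
        · exact x_le_z_succ _
        · exact (hs (.x_center _ h)).trans (hs (.center_z _ (Nat.not_even_iff_odd.1 h')))
      · exact hs (.x_center _ h)
      · rcases h with rfl | rfl
        · exact hs (.y_z _)
        · exact e2 _
      · exact hs (.center_z _ (Nat.not_even_iff_odd.1 h))

theorem Below.height_lt {a b : PC n} (h : Below a b) : a.height < b.height := by
  cases a <;> cases b <;> simp_all [Below, height]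

theorem lt_iff (a b : PC n) : a < b ↔ Below a b := by
  rw [lt_iff_le_and_ne, le_iff]
  constructor
  · rintro ⟨h | h, h'⟩
    · exact absurd h h'
    · exact h
  · intro h
    refine ⟨.inr h, ?_⟩
    rintro rfl
    exact lt_irrefl _ h.height_lt

theorem height_strictMono : StrictMono (height : PC n → ℕ) := fun a b h =>
  ((lt_iff a b).1 h).height_lt

theorem ev_add_one (hn : Even n) (h4 : 4 ≤ n) (i : ZMod n) : Ev (i + 1) ↔ ¬ Ev i := by
  have : NeZero n := ⟨by omega⟩
  have : Fact (1 < n) := ⟨by omega⟩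
  rw [Ev, Ev, ZMod.val_add, ZMod.val_one, Nat.even_iff, Nat.even_iff,
    Nat.mod_mod_of_dvd _ hn.two_dvd]
  omega

theorem natCast_ne_zero {k : ℕ} (h0 : 0 < k) (hk : k < n) : (k : ZMod n) ≠ 0 := by
  rw [Ne, ZMod.natCast_eq_zero_iff]
  exact fun h => absurd (Nat.le_of_dvd h0 h) (by omega)

/-- The arithmetic of indices. -/
structure Arith (n : ℕ) : Prop where
  one : (1 : ZMod n) ≠ 0
  two : (2 : ZMod n) ≠ 0
  three : (3 : ZMod n) ≠ 0
  ev : ∀ i j : ZMod n, Ev i → Ev j → i ≠ j + 1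
  odd : ∀ i j : ZMod n, ¬ Ev i → ¬ Ev j → i ≠ j + 1
  succ : ∀ i : ZMod n, Ev (i + 1) ↔ ¬ Ev i

theorem arith (hn : Even n) (h4 : 4 ≤ n) : Arith n where
  one := by simpa using natCast_ne_zero (n := n) (k := 1) (by omega) (by omega)
  two := by simpa using natCast_ne_zero (n := n) (k := 2) (by omega) (by omega)
  three := by simpa using natCast_ne_zero (n := n) (k := 3) (by omega) (by omega)
  ev i j hi hj h := by subst h; exact (ev_add_one hn h4 j).1 hi hj
  odd i j hi hj h := by subst h; exact hi ((ev_add_one hn h4 j).2 hj)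
  succ := ev_add_one hn h4

theorem Arith.pred (h : Arith n) (i : ZMod n) : Ev (i - 1) ↔ ¬ Ev i := by
  have := h.succ (i - 1)
  rw [sub_add_cancel] at this
  tauto

/-- Distinct `y_i` share at most one upper bound `z_j` because `2 ≠ 0`, and of the two `z_j` above a
given `y_i` one has even index, hence is not above the centre. -/
theorem localMeets (h : Arith n) : LocalMeets (PC n) := by
  obtain ⟨h1, h2, h3, h4, h5, -⟩ := h
  refine localMeets_of_forall ?_
  intro s w w' t t'
  simp only [lt_iff]
  cases s <;> cases w <;> simp only [Below, false_imp_iff, imp_true_iff] <;>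
  cases w' <;> simp only [false_imp_iff, imp_true_iff] <;>
  cases t <;> simp only [false_imp_iff, imp_true_iff] <;>
  cases t' <;> simp only [false_imp_iff, imp_true_iff] <;> grind

theorem localMeets_dual (h : Arith n) : LocalMeets (PC n)ᵒᵈ := by
  obtain ⟨h1, h2, h3, h4, h5, -⟩ := h
  refine localMeets_of_forall ?_
  suffices h : ∀ s w w' t t' : PC n, w < s → w' < s → t < w → t' < w → t < w' → t' < w' → t ≠ t' →
      w = w' from h
  intro s w w' t t'
  simp only [lt_iff]
  cases s <;> cases w <;> simp only [Below, false_imp_iff, imp_true_iff] <;>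
  cases w' <;> simp only [false_imp_iff, imp_true_iff] <;>
  cases t <;> simp only [false_imp_iff, imp_true_iff] <;>
  cases t' <;> simp only [false_imp_iff, imp_true_iff] <;> grind

theorem card (hn : n ≠ 0) : Nat.card (PC n) = 3 * n + 1 := by
  have : NeZero n := ⟨hn⟩
  let e : PC n ≃ Option (ZMod n ⊕ ZMod n ⊕ ZMod n) :=
    { toFun := fun a => match a with
        | x i => some (.inl i)
        | y i => some (.inr (.inl i))
        | z i => some (.inr (.inr i))
        | center => none
      invFun := fun a => match a with
        | some (.inl i) => x i
        | some (.inr (.inl i)) => y i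
        | some (.inr (.inr i)) => z i
        | none => center
      left_inv := fun a => by cases a <;> rfl
      right_inv := fun a => by rcases a with _ | _ | _ | _ <;> rfl }
  rw [Nat.card_congr e, Finite.card_option, Nat.card_sum, Nat.card_sum, Nat.card_zmod]
  ring

/-! ### Strong turns -/

/-- An explicit description of the triples that satisfy `StrongPeak` or `StrongValley`. -/
def Turn : PC n → PC n → PC n → Prop
  | x k, z j, x m => (Ev j ∧ (k = j - 1 ∧ m = j + 1 ∨ k = j + 1 ∧ m = j - 1)) ∨
      (¬ Ev j ∧ (Ev k ∧ m = j ∧ k ≠ j + 1 ∧ k ≠ j - 1 ∨ k = j ∧ Ev m ∧ m ≠ j + 1 ∧ m ≠ j - 1))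
  | x k, z j, y m => (Ev j ∧ (k = j - 1 ∧ m = j ∨ k = j + 1 ∧ m = j - 1)) ∨
      (¬ Ev j ∧ Ev k ∧ (m = j ∧ k ≠ j + 1 ∨ m = j - 1 ∧ k ≠ j - 1))
  | x k, z j, center => ¬ Ev j ∧ k = j
  | x k, y j, x m => k = j ∧ m = j + 1 ∨ k = j + 1 ∧ m = j
  | x k, center, x m => Ev k ∧ Ev m ∧ k ≠ m
  | z k, x j, z m => (¬ Ev j ∧ (k = j - 1 ∧ m = j + 1 ∨ k = j + 1 ∧ m = j - 1)) ∨
      (Ev j ∧ (¬ Ev k ∧ m = j ∧ k ≠ j + 1 ∧ k ≠ j - 1 ∨ k = j ∧ ¬ Ev m ∧ m ≠ j + 1 ∧ m ≠ j - 1))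
  | z k, x j, y m => (¬ Ev j ∧ (k = j - 1 ∧ m = j ∨ k = j + 1 ∧ m = j - 1)) ∨
      (Ev j ∧ ¬ Ev k ∧ (m = j ∧ k ≠ j + 1 ∨ m = j - 1 ∧ k ≠ j - 1))
  | z k, x j, center => Ev j ∧ k = j
  | z k, y j, z m => k = j ∧ m = j + 1 ∨ k = j + 1 ∧ m = j
  | z k, center, z m => ¬ Ev k ∧ ¬ Ev m ∧ k ≠ m
  | _, _, _ => False

theorem _root_.MultifractionReduction.StrongPeak.turn (h : Arith n) {p v w : PC n}
    (hs : StrongPeak p v w) : Turn p v w := by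
  have a1 := h.succ
  have a2 := h.pred
  obtain ⟨h1, h2, h3, -, -, -⟩ := h
  obtain ⟨hp, hw, hs⟩ := hs
  have e1 := hs w p
  rw [lt_iff] at hp hw
  simp only [le_iff] at hs e1
  cases v with
  | x i => cases p <;> simp [Below] at hp
  | y j =>
    cases p <;> simp only [Below] at hp <;> cases w <;>
      simp only [Below, Turn] at hw e1 ⊢ <;> grind
  | center =>
    cases p <;> simp only [Below] at hp <;> cases w <;>
      simp only [Below, Turn] at hw e1 ⊢ <;> grind
  | z j =>
    -- The elements of height 1 below `z j`, tested against the natural lower bounds, already decide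
    -- strength.
    have e2 := hs (y j) p
    have e3 := hs (y (j - 1)) p
    have e4 := hs center p
    have e5 := hs (y j) (x j)
    have e6 := hs (y j) (x (j + 1))
    have e7 := hs (y (j - 1)) (x j)
    have e8 := hs (y (j - 1)) (x (j - 1))
    have e9 := hs center (x (j + 1))
    have e10 := hs center (x (j - 1))
    have e11 := hs w w
    clear hs
    have b1 := a1 j
    have b2 := a2 j
    by_cases hj : Ev j <;> cases p <;> simp only [Below, hj] at hp <;> cases w <;>
      simp [Below, hj, a1, a2] at hw e1 e2 e3 e4 e5 e6 e7 e8 e9 e10 e11 <;>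
      simp only [Turn, hj] <;> clear a1 a2 <;>
      try simp only [not_true, not_false_iff, true_and, false_and, and_false, or_false,
        false_or] at hp ⊢
    all_goals grind

theorem _root_.MultifractionReduction.StrongValley.turn (h : Arith n) {p v w : PC n}
    (hs : StrongValley p v w) : Turn p v w := by
  have a1 := h.succ
  have a2 := h.pred
  obtain ⟨h1, h2, h3, -, -, -⟩ := h
  obtain ⟨hp, hw, hs⟩ := hs
  have e1 := hs w p
  rw [lt_iff] at hp hw
  simp only [le_iff] at hs e1
  cases v with
  | z i => cases p <;> simp [Below] at hp
  | y j =>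
    cases p <;> simp only [Below] at hp <;> cases w <;>
      simp only [Below, Turn] at hw e1 ⊢ <;> grind
  | center =>
    cases p <;> simp only [Below] at hp <;> cases w <;>
      simp only [Below, Turn] at hw e1 ⊢ <;> grind
  | x j =>
    have e2 := hs (y j) p
    have e3 := hs (y (j - 1)) p
    have e4 := hs center p
    have e5 := hs (y j) (z j)
    have e6 := hs (y j) (z (j + 1))
    have e7 := hs (y (j - 1)) (z j)
    have e8 := hs (y (j - 1)) (z (j - 1))
    have e9 := hs center (z (j + 1))
    have e10 := hs center (z (j - 1))
    have e11 := hs w w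
    clear hs
    have b1 := a1 j
    have b2 := a2 j
    by_cases hj : Ev j <;> cases p <;> simp only [Below, hj] at hp <;> cases w <;>
      simp [Below, hj, a1, a2] at hw e1 e2 e3 e4 e5 e6 e7 e8 e9 e10 e11 <;>
      simp only [Turn, hj] <;> clear a1 a2 <;>
      try simp only [not_true, not_false_iff, true_and, false_and, and_false, or_false,
        false_or] at hp ⊢
    all_goals grind

/-! ### The necklace and the absence of short loops -/

/-- Comparability of distinct elements. -/
def Comp (a b : PC n) : Prop := Below a b ∨ Below b a

/-- The maximal vertices of even index and the minimal vertices of odd index. -/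
noncomputable def bead (j : ZMod n) : PC n := by classical exact if Ev j then z j else x j

/-- The vertex between `bead j` and `bead (j + s)`, for `s = 1` or `s = -1`. -/
noncomputable def mid (s j : ZMod n) : PC n := by classical exact if s = 1 then y j else y (j - 1)

/-- A strong turn after a step along the necklace keeps the direction `s`, with a full step or half
of one. -/
theorem Turn.bead_or_mid (h : Arith n) {s j : ZMod n} (hs : s = 1 ∨ s = -1) {w : PC n}
    (ht : Turn (bead (j - s)) (bead j) w) : w = bead (j + s) ∨ w = mid s j := by
  have a1 := h.succ
  have a2 := h.pred
  obtain ⟨h1, h2, h3, -, -, -⟩ := h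
  have h11 : (-1 : ZMod n) ≠ 1 := fun h => h2 (by linear_combination -h)
  have c1 : j - 1 ≠ j + 1 := fun h => h2 (by linear_combination -h)
  have c2 : j ≠ j - 1 := fun h => h1 (by linear_combination h)
  by_cases hj : Ev j <;> rcases hs with rfl | rfl <;>
    simp only [bead, mid, hj, a1, a2, sub_neg_eq_add, ← sub_eq_add_neg, h11, if_true, if_false,
      not_true, not_false_iff] at ht ⊢ <;>
    cases w <;> simp only [Turn, hj, not_true, not_false_iff, true_and, false_and, and_false,
      or_false, false_or] at ht <;> grind

theorem Turn.of_bead_mid (h : Arith n) {s j : ZMod n} (hs : s = 1 ∨ s = -1) {w : PC n}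
    (ht : Turn (bead j) (mid s j) w) : (Ev j ∧ w = z (j + s)) ∨ (¬ Ev j ∧ w = x (j + s)) := by
  obtain ⟨h1, h2, h3, -, -, -⟩ := h
  have h11 : (-1 : ZMod n) ≠ 1 := fun h => h2 (by linear_combination -h)
  have c1 : j - 1 ≠ j + 1 := fun h => h2 (by linear_combination -h)
  have c2 : j ≠ j - 1 := fun h => h1 (by linear_combination h)
  by_cases hj : Ev j <;> rcases hs with rfl | rfl <;>
    simp only [bead, mid, hj, h11, ← sub_eq_add_neg, if_true, if_false] at ht ⊢ <;>
    cases w <;> simp only [Turn] at ht <;> grind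

theorem Comp.of_bead_bead {i j : ZMod n} (hc : Comp (bead i) (bead j)) :
    i = j + 1 ∨ j = i + 1 := by
  by_cases hi : Ev i <;> by_cases hj : Ev j <;>
    simp only [Comp, Below, bead, hi, hj, if_true, if_false, not_true, false_and, and_false,
      or_false, false_or] at hc
  all_goals
    rcases hc with rfl | hc
    · contradiction
    · tauto

theorem Comp.of_mid_bead (h : Arith n) {s i j : ZMod n} (hs : s = 1 ∨ s = -1)
    (hc : Comp (mid s i) (bead j)) : j = i ∨ j = i + s := by
  obtain ⟨h1, h2, h3, -, -, -⟩ := h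
  have h11 : (-1 : ZMod n) ≠ 1 := fun h => h2 (by linear_combination -h)
  have c1 : j - 1 ≠ j + 1 := fun h => h2 (by linear_combination -h)
  have c2 : j ≠ j - 1 := fun h => h1 (by linear_combination h)
  by_cases hj : Ev j <;> rcases hs with rfl | rfl <;>
    simp only [Comp, Below, bead, mid, hj, h11, if_true, if_false, or_false, false_or] at hc <;>
    grind

/-- The vertex `w` has index `i + s` and is not a bead. The centre relates it to non-beads only, and
parity excludes the beads of neighbouring index. -/
theorem Comp.of_antibead_bead (h : Arith n) {s i j : ZMod n} (hs : s = 1 ∨ s = -1)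
    (hw : ∃ w, ((Ev i ∧ w = z (i + s)) ∨ (¬ Ev i ∧ w = x (i + s))) ∧ Comp w (bead j)) :
    j = i + s := by
  have a1 := h.succ
  have a2 := h.pred
  obtain ⟨w, ⟨hi, rfl⟩ | ⟨hi, rfl⟩, hc⟩ := hw <;> by_cases hj : Ev j <;>
    rcases hs with rfl | rfl <;>
    simp only [Comp, Below, bead, hj, hi, a1, a2, ← sub_eq_add_neg, if_true, if_false, not_true,
      false_and, and_false, or_false, false_or, not_false_iff, and_true, true_and] at hc <;>
    grind

/-- Hence no turn starts at a `y_i` or at the centre: these are dead ends for a loop. -/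
theorem Turn.left (p v w : PC n) (ht : Turn p v w) : (∃ i, p = x i) ∨ ∃ i, p = z i := by
  cases p <;> cases v <;> simp_all [Turn]

/-- The triples of `Turn` that do not follow the necklace. -/
def Detour : PC n → PC n → PC n → Prop
  | x k, z j, x m =>
      ¬ Ev j ∧ (Ev k ∧ m = j ∧ k ≠ j + 1 ∧ k ≠ j - 1 ∨ k = j ∧ Ev m ∧ m ≠ j + 1 ∧ m ≠ j - 1)
  | x k, z j, y m => ¬ Ev j ∧ Ev k ∧ (m = j ∧ k ≠ j + 1 ∨ m = j - 1 ∧ k ≠ j - 1)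
  | x k, z j, center => ¬ Ev j ∧ k = j
  | x k, y j, x m => k = j ∧ m = j + 1 ∨ k = j + 1 ∧ m = j
  | x k, center, x m => Ev k ∧ Ev m ∧ k ≠ m
  | z k, x j, z m =>
      Ev j ∧ (¬ Ev k ∧ m = j ∧ k ≠ j + 1 ∧ k ≠ j - 1 ∨ k = j ∧ ¬ Ev m ∧ m ≠ j + 1 ∧ m ≠ j - 1)
  | z k, x j, y m => Ev j ∧ ¬ Ev k ∧ (m = j ∧ k ≠ j + 1 ∨ m = j - 1 ∧ k ≠ j - 1)
  | z k, x j, center => Ev j ∧ k = j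
  | z k, y j, z m => k = j ∧ m = j + 1 ∨ k = j + 1 ∧ m = j
  | z k, center, z m => ¬ Ev k ∧ ¬ Ev m ∧ k ≠ m
  | _, _, _ => False

/-- The pair `(a, b)` is a step along the necklace. -/
def OnNecklace (a b : PC n) : Prop :=
  ∃ s j : ZMod n, (s = 1 ∨ s = -1) ∧ a = bead (j - s) ∧ b = bead j

theorem Turn.necklace_or_detour (h : Arith n) {a b c : PC n} (ht : Turn a b c) :
    OnNecklace a b ∨ Detour a b c := by
  have a1 := h.succ
  have a2 := h.pred
  have even : ∀ k j : ZMod n, Ev j → (k = j - 1 ∨ k = j + 1) →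
      OnNecklace (x k) (z j) := by
    rintro k j hj (rfl | rfl)
    · exact ⟨1, j, .inl rfl, by simp [bead, a2, hj], by simp [bead, hj]⟩
    · exact ⟨-1, j, .inr rfl, by simp [bead, a1, hj], by simp [bead, hj]⟩
  have odd : ∀ k j : ZMod n, ¬ Ev j → (k = j - 1 ∨ k = j + 1) →
      OnNecklace (z k) (x j) := by
    rintro k j hj (rfl | rfl)
    · exact ⟨1, j, .inl rfl, by simp [bead, a2, hj], by simp [bead, hj]⟩
    · exact ⟨-1, j, .inr rfl, by simp [bead, a1, hj], by simp [bead, hj]⟩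
  clear a1 a2
  cases a <;> cases b <;> simp only [Turn] at ht <;> cases c <;>
    simp only [Turn, Detour] at ht ⊢ <;> grind

/-- Within a few steps a detour reaches a `y_i`, the centre, or a vertex whose index has the wrong
parity for a further turn. Closing up earlier, at `v₄` or `v₅`, contradicts the comparability of
`v₀` and `v₁`. -/
theorem onNecklace_of_turn (h : Arith n) {v₀ v₁ v₂ v₃ v₄ : PC n} (hc : Comp v₀ v₁)
    (h1 : Turn v₁ v₂ v₃) (h2 : Turn v₂ v₃ v₄)
    (h3 : v₄ = v₀ ∨ ∃ v₅, Turn v₃ v₄ v₅ ∧ (v₅ = v₀ ∨ ∃ v₆, Turn v₄ v₅ v₆)) :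
    OnNecklace v₁ v₂ := by
  refine (h1.necklace_or_detour h).resolve_right fun h1 => ?_
  obtain ⟨a1, a2, a3, -, -, a4⟩ := h
  rcases h3 with rfl | ⟨v₅, h3, rfl | ⟨v₆, h4⟩⟩
  · cases v₁ <;> cases v₂ <;> simp only [Detour] at h1 <;> cases v₃ <;>
      simp only [Detour, Turn] at h1 h2 <;> cases v₄ <;>
      simp only [Turn, Comp, Below, or_false, false_or] at h2 hc <;> grind
  · cases v₁ <;> cases v₂ <;> simp only [Detour] at h1 <;> cases v₃ <;>
      simp only [Detour, Turn] at h1 h2 <;> cases v₄ <;>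
      simp only [Turn] at h2 h3 <;> cases v₅ <;>
      simp only [Turn, Comp, Below, or_false, false_or] at h3 hc <;> grind
  · cases v₁ <;> cases v₂ <;> simp only [Detour] at h1 <;> cases v₃ <;>
      simp only [Detour, Turn] at h1 h2 <;> cases v₄ <;>
      simp only [Turn] at h2 h3 <;> cases v₅ <;>
      simp only [Turn] at h3 h4 <;> grind

theorem comp_of_lt {a b : PC n} (h : a < b) : Comp a b := .inl ((lt_iff a b).1 h)

theorem comp_of_gt {a b : PC n} (h : b < a) : Comp a b := .inr ((lt_iff b a).1 h)

theorem not_isIrredLoop (h : Arith n) {l : ℕ} (hl : l < n) (v : ℕ → PC n) :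
    ¬ IsIrredLoop l v := by
  rintro ⟨h2, hclosed, hweak, hstrong⟩
  have hturn : ∀ k, k + 3 ≤ l → Turn (v (k + 1)) (v (k + 2)) (v (k + 3)) := fun k hk =>
    (hstrong k hk).elim (·.turn h) (·.turn h)
  have hcomp : Comp (v 0) (v 1) := hweak.elim (fun h => comp_of_lt h.1) (fun h => comp_of_gt h.1)
  -- Loops of length 2 and 3 contradict the weak turn, tested at `w = v 0`, or the alternation of
  -- peaks and valleys.
  rcases eq_or_ne l 2 with rfl | hl2
  · rw [hclosed] at hweak
    rcases hweak with hw | hw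
    · exact hw.1.ne (hw.2.2 _ le_rfl le_rfl hw.1.le)
    · exact hw.1.ne' (hw.2.2 _ le_rfl le_rfl hw.1.le)
  rcases eq_or_ne l 3 with rfl | hl3
  · have h3 := hstrong 0 le_rfl
    simp only [Nat.zero_add, hclosed] at h3
    rcases hweak with hw | hw <;> rcases h3 with h3 | h3
    · exact absurd hw.2.1 h3.1.not_gt
    · exact hw.1.ne (hw.2.2 _ le_rfl h3.2.1.le hw.1.le)
    · exact hw.1.ne' (hw.2.2 _ le_rfl h3.2.1.le hw.1.le)
    · exact absurd hw.2.1 h3.1.not_gt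
  have hl4 : 4 ≤ l := by omega
  obtain ⟨s, j, hs, hv1, hv2⟩ : OnNecklace (v 1) (v 2) := by
    refine onNecklace_of_turn h hcomp (hturn 0 (by omega)) (hturn 1 (by omega)) ?_
    rcases eq_or_ne l 4 with rfl | hl4
    · exact .inl hclosed
    · refine .inr ⟨v 5, hturn 2 (by omega), ?_⟩
      rcases eq_or_ne l 5 with rfl | hl5
      · exact .inl hclosed
      · exact .inr ⟨v 6, hturn 3 (by omega)⟩
  have hmid : ∀ (i : ZMod n) (p w : PC n), ¬ Turn (mid s i) p w := by
    intro i p w ht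
    rcases ht.left with ⟨k, hk⟩ | ⟨k, hk⟩ <;> simp only [mid] at hk <;> split at hk <;> cases hk
  -- By induction the path follows the beads: a half step here would have to be followed by a turn
  -- starting at a dead end. Only the last two vertices escape this argument.
  have hbead : ∀ k, k + 4 ≤ l →
      v (k + 1) = bead (j + ((k : ZMod n) - 1) * s) ∧
      v (k + 2) = bead (j + (k : ZMod n) * s) := by
    intro k
    induction k with
    | zero =>
      intro _
      refine ⟨?_, ?_⟩
      · rw [hv1]; congr 1; push_cast; ring
      · rw [hv2]; congr 1; push_cast; ring
    | succ k ih =>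
      intro hk
      obtain ⟨e1, e2⟩ := ih (by omega)
      have ht := hturn k (by omega)
      have e3 : j + ((k : ZMod n) - 1) * s = j + k * s - s := by ring
      rw [e1, e2, e3] at ht
      refine ⟨?_, ?_⟩
      · rw [show k + 1 + 1 = k + 2 from rfl, e2]; congr 1; push_cast; ring
      · rcases ht.bead_or_mid h hs with e | e
        · rw [show k + 1 + 2 = k + 3 from rfl, e]; congr 1; push_cast; ring
        · have ht' := hturn (k + 2) (by omega)
          rw [show k + 2 + 1 = k + 3 from rfl, e] at ht'
          exact absurd ht' (hmid _ _ _)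
  obtain ⟨m, rfl⟩ : ∃ m, l = m + 4 := ⟨l - 4, by omega⟩
  obtain ⟨e1, e2⟩ := hbead m le_rfl
  have ht := hturn m (by omega)
  have ht' := hturn (m + 1) (by omega)
  rw [show m + 1 + 1 = m + 2 from rfl, show m + 1 + 2 = m + 3 from rfl,
    show m + 1 + 3 = m + 4 from rfl, hclosed] at ht'
  have e3 : j + ((m : ZMod n) - 1) * s = j + m * s - s := by ring
  rw [e1, e2, e3] at ht
  -- The last vertex equals `v 0`, so it is comparable to `v 1 = bead (j - s)`. In each case this
  -- makes one of `m + 2`, `m + 3`, `m + 4` vanish modulo `n`, although `0 < m + 2` and `m + 4 = l <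
  -- n`.
  have n2 : ((m + 2 : ℕ) : ZMod n) ≠ 0 := natCast_ne_zero (by omega) (by omega)
  have n3 : ((m + 3 : ℕ) : ZMod n) ≠ 0 := natCast_ne_zero (by omega) (by omega)
  have n4 : ((m + 4 : ℕ) : ZMod n) ≠ 0 := natCast_ne_zero (by omega) (by omega)
  have hss : s * s = 1 := by rcases hs with rfl | rfl <;> ring
  rw [hv1] at hcomp
  push_cast at n2 n3 n4
  rw [e2] at ht'
  rcases ht.bead_or_mid h hs with e | e
  · rw [e] at ht'
    rw [← add_sub_cancel_right (j + (m : ZMod n) * s) s, sub_add_cancel] at ht'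
    rcases ht'.bead_or_mid h hs with e' | e'
    · rw [e'] at hcomp
      have hone : s = 1 ∨ s = -1 := hs
      rcases hcomp.of_bead_bead with hc | hc <;> rcases hone with rfl | rfl
      · exact n2 (by linear_combination hc)
      · exact n4 (by linear_combination -hc)
      · exact n4 (by linear_combination -hc)
      · exact n2 (by linear_combination hc)
    · rw [e'] at hcomp
      rcases hcomp.of_mid_bead h hs with hc | hc
      · exact n2 (by linear_combination -s * hc - (m + 2) * hss)
      · exact n3 (by linear_combination -s * hc - (m + 3) * hss)
  · rw [e] at ht'
    have hc := Comp.of_antibead_bead h hs ⟨_, ht'.of_bead_mid h hs, hcomp⟩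
    exact n2 (by linear_combination -s * hc - (m + 2) * hss)

end PC

/-! ### The potential and the unitality of the witness -/

/-- The image of `[s, t]` in the enveloping group, with value `1` if `s ≤ t` fails. -/
noncomputable def envLetter {P : Type*} [PartialOrder P] (s t : P) :
    EnvelopingGroup (IntervalMonoid P) := can _ (letter (s, t))

theorem envLetter_of_le {P : Type*} [PartialOrder P] {s t : P} (h : s ≤ t) :
    envLetter s t = can _ (ivl s t h) := by rw [envLetter, letter_of_le h]

theorem envLetter_mul {P : Type*} [PartialOrder P] {s t r : P} (h : s ≤ t) (h' : t ≤ r) :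
    envLetter s t * envLetter t r = envLetter s r := by
  rw [envLetter_of_le h, envLetter_of_le h', envLetter_of_le (h.trans h'), ← map_mul, ivl_mul_ivl]

namespace PC

variable {n : ℕ}

theorem step_le {a b : PC n} (h : Step n a b) : a ≤ b := Relation.ReflTransGen.single h

open scoped Classical in
/-- A potential on the vertices for the images of the intervals in the enveloping group. -/
noncomputable def potential : PC n → EnvelopingGroup (MC n)
  | x i => if Ev i then (envLetter (x i) center)⁻¹
      else envLetter center (z i) * (envLetter (x i) (z i))⁻¹
  | z i => if Ev i then (envLetter (x i) center)⁻¹ * envLetter (x i) (z i)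
      else envLetter center (z i)
  | y i => if Ev i then (envLetter (x i) center)⁻¹ * envLetter (x i) (y i)
      else envLetter center (z i) * (envLetter (y i) (z i))⁻¹
  | center => 1

/-- `potential` fixes one route from the centre to each vertex. The other relations hold because
`[x_i, z_{i+1}]` for `i` even, and `[x_{i+1}, z_i]` for `i` odd, factor both through `y_i` and
through the centre. -/
theorem potential_step (h : Arith n) {a b : PC n} (hs : Step n a b) :
    potential b = potential a * envLetter a b := by
  have xz : ∀ i : ZMod n, potential (z i) = potential (x i) * envLetter (x i) (z i) := by
    intro i
    by_cases hi : Ev i <;> simp [potential, hi]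
  have xc : ∀ i : ZMod n, Ev i → (x i : PC n) ≤ center := fun i hi => step_le (.x_center i hi)
  have cz : ∀ i : ZMod n, ¬ Ev i → (center : PC n) ≤ z i := fun i hi =>
    step_le (.center_z i (Nat.not_even_iff_odd.1 hi))
  have xy : ∀ i : ZMod n, (x i : PC n) ≤ y i := fun i => step_le (.x_y i)
  have yz : ∀ i : ZMod n, (y i : PC n) ≤ z i := fun i => step_le (.y_z i)
  have xy' : ∀ i : ZMod n, (x (i + 1) : PC n) ≤ y i := fun i => by
    have := Step.x_y_pred (i + 1)
    rw [add_sub_cancel_right] at this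
    exact step_le this
  have yz' : ∀ i : ZMod n, (y i : PC n) ≤ z (i + 1) := fun i => by
    have := Step.y_pred_z (i + 1)
    rw [add_sub_cancel_right] at this
    exact step_le this
  have h1 : ∀ i : ZMod n, potential (y i) = potential (x i) * envLetter (x i) (y i) := by
    intro i
    by_cases hi : Ev i
    · simp [potential, hi]
    · simp only [potential, hi, if_false]
      rw [← envLetter_mul (xy i) (yz i)]
      group
  have h2 : ∀ i : ZMod n, potential (z i) = potential (y i) * envLetter (y i) (z i) := by
    intro i
    rw [xz, h1, mul_assoc, envLetter_mul (xy i) (yz i)]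
  have h3 : ∀ i : ZMod n, potential (y i) = potential (x (i + 1)) * envLetter (x (i + 1)) (y i) ∧
      potential (z (i + 1)) = potential (y i) * envLetter (y i) (z (i + 1)) := by
    intro i
    by_cases hi : Ev i
    · have hi' : ¬ Ev (i + 1) := fun h' => (h.succ i).1 h' hi
      have e1 : potential (z (i + 1)) = potential (y i) * envLetter (y i) (z (i + 1)) := by
        simp only [potential, hi, hi', if_true, if_false]
        rw [mul_assoc, envLetter_mul (xy i) (yz' i),
          ← envLetter_mul (xc i hi) (cz _ hi'), inv_mul_cancel_left]
      refine ⟨?_, e1⟩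
      rw [xz, ← envLetter_mul (xy' i) (yz' i), ← mul_assoc, mul_left_inj] at e1
      exact e1.symm
    · have hi' : Ev (i + 1) := (h.succ i).2 hi
      have e1 : potential (y i) = potential (x (i + 1)) * envLetter (x (i + 1)) (y i) := by
        simp only [potential, hi, hi', if_true, if_false]
        rw [mul_inv_eq_iff_eq_mul, mul_assoc, envLetter_mul (xy' i) (yz i),
          ← envLetter_mul (xc _ hi') (cz i hi), inv_mul_cancel_left]
      refine ⟨e1, ?_⟩
      rw [xz, e1, mul_assoc, envLetter_mul (xy' i) (yz' i)]
  cases hs with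
  | x_y i => exact h1 i
  | y_z i => exact h2 i
  | x_y_pred i =>
    have := (h3 (i - 1)).1
    rwa [sub_add_cancel] at this
  | y_pred_z i =>
    have := (h3 (i - 1)).2
    rwa [sub_add_cancel] at this
  | x_center i hi =>
    have hi : Ev i := hi
    simp [potential, hi]
  | center_z i hi =>
    have hi : ¬ Ev i := Nat.not_even_iff_odd.2 hi
    simp [potential, hi]

theorem potential_of_le (h : Arith n) {a b : PC n} (hab : a ≤ b) :
    potential b = potential a * envLetter a b := by
  induction (show Relation.ReflTransGen (Step n) a b from hab) with
  | refl => rw [envLetter_of_le le_rfl, ivl_self, map_one, mul_one]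
  | tail hac hcb ih =>
    rw [potential_step h hcb, ih hac, mul_assoc, envLetter_mul hac (step_le hcb)]

theorem can_up (h : Arith n) (i : ZMod n) :
    can (MC n) (up i) = (potential (x i))⁻¹ * potential (z (i + 1)) := by
  rw [potential_of_le h (x_le_z_succ i), inv_mul_cancel_left, envLetter_of_le (x_le_z_succ i), up]

theorem can_down (h : Arith n) (i : ZMod n) :
    can (MC n) (down i) = (potential (x (i + 1)))⁻¹ * potential (z i) := by
  rw [potential_of_le h (x_succ_le_z i), inv_mul_cancel_left, envLetter_of_le (x_succ_le_z i),
    down]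

/-- The entry of index `k + 1` of the witness. -/
def entry (n k : ℕ) : Bool × MC n :=
  if Even k then (true, up ((k + 1 : ℕ) : ZMod n)) else (false, down ((k + 1 : ℕ) : ZMod n))

/-- The product telescopes: after `k` entries the zigzag stands at `x_{k+1}` or `z_{k+1}`, according
to parity. -/
theorem evalList_entries (h : Arith n) (k : ℕ) :
    evalList ((List.range k).map (entry n)) = (potential (x (1 : ZMod n)))⁻¹ *
      if Even k then potential (x ((k : ZMod n) + 1)) else potential (z ((k : ZMod n) + 1)) := by
  induction k with
  | zero => simp [evalList]
  | succ k ih =>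
    have hsplit : evalList ((List.range (k + 1)).map (entry n)) =
        evalList ((List.range k).map (entry n)) * evalList [entry n k] := by
      simp [evalList, List.range_succ]
    rw [hsplit, ih]
    by_cases hk : Even k
    · simp [evalList, entry, hk, Nat.even_add_one, can_up h, mul_assoc]
    · simp [evalList, entry, hk, Nat.even_add_one, can_down h, mul_assoc]

theorem witness_unital (hn : Even n) (h4 : 4 ≤ n) : (witness n).Unital := by
  have h := evalList_entries (arith hn h4) n
  rw [if_pos hn, ZMod.natCast_self, zero_add, inv_mul_cancel] at h
  exact h

/-! ### Irreducibility of the witness -/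

/-- The centre is not below a `z` of even index. What remains strictly below the peak and above
`x_{i+2}` is `x_{i+2}` and `y_{i+1}`, neither of which is above `x_i`. -/
theorem strongPeak_odd (h : Arith n) {i : ZMod n} (hi : ¬ Ev i) :
    StrongPeak (x i : PC n) (z (i + 1)) (x (i + 1 + 1)) := by
  refine ⟨(lt_iff _ _).2 (by simp [Below]), (lt_iff _ _).2 (by simp [Below]), ?_⟩
  have a1 := h.succ i
  have a2 := h.succ (i + 1)
  have h1 := h.one
  have h2 := h.two
  have h3 := h.three
  intro w q
  simp only [le_iff]
  cases w <;> cases q <;> simp only [Below] <;> grind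

theorem strongPeak_odd' (h : Arith n) {i : ZMod n} (hi : ¬ Ev i) :
    StrongPeak (x (i + 1 + 1) : PC n) (z (i + 1)) (x i) := by
  refine ⟨(lt_iff _ _).2 (by simp [Below]), (lt_iff _ _).2 (by simp [Below]), ?_⟩
  have a1 := h.succ i
  have a2 := h.succ (i + 1)
  have h1 := h.one
  have h2 := h.two
  have h3 := h.three
  intro w q
  simp only [le_iff]
  cases w <;> cases q <;> simp only [Below] <;> grind

theorem strongValley_even (h : Arith n) {i : ZMod n} (hi : Ev i) :
    StrongValley (z i : PC n) (x (i + 1)) (z (i + 1 + 1)) := by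
  refine ⟨(lt_iff _ _).2 (by simp [Below]), (lt_iff _ _).2 (by simp [Below]), ?_⟩
  have a1 := h.succ i
  have a2 := h.succ (i + 1)
  have h1 := h.one
  have h2 := h.two
  have h3 := h.three
  intro w q
  simp only [le_iff]
  cases w <;> cases q <;> simp only [Below] <;> grind

theorem ev_natCast (hn : Even n) (h4 : 4 ≤ n) (k : ℕ) : Ev (k : ZMod n) ↔ Even k := by
  induction k with
  | zero => simp [Ev]
  | succ k ih =>
    rw [Nat.cast_succ, ev_add_one hn h4, ih, Nat.even_add_one]

theorem witness_getElem? (k : ℕ) : (witness n).1[k]? = if k < n then some (entry n k) else none := by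
  change ((List.range n).map (entry n))[k]? = _
  rw [List.getElem?_map]
  split_ifs with h
  · simp [List.getElem?_range h]
  · simp [List.getElem?_eq_none (l := List.range n) (by simpa using h)]

theorem eq_entry_of_witness {k : ℕ} {e : Bool × MC n} (h : (witness n).1[k]? = some e) :
    e = entry n k := by
  rw [witness_getElem?] at h
  split_ifs at h
  exact (Option.some.inj h).symm

theorem up_mul_eq (h : Arith n) {i : ZMod n} (hi : ¬ Ev i) {a b c d : MC n}
    (h1 : b * a = d * up i) (h2 : c * a = down (i + 1)) : a = 1 :=
  (strongPeak_odd h hi).eq_one h1 h2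

theorem down_mul_eq (h : Arith n) {i : ZMod n} (hi : ¬ Ev i) {a b c d : MC n}
    (h1 : b * a = d * down (i + 1)) (h2 : c * a = up i) : a = 1 :=
  (strongPeak_odd' h hi).eq_one h1 h2

theorem mul_down_eq (h : Arith n) {i : ZMod n} (hi : Ev i) {a b c d : MC n}
    (h1 : a * b = down i * d) (h2 : a * c = up (i + 1)) : a = 1 :=
  (strongValley_even h hi).eq_one h1 h2

/-- Any rule would give a nontrivial divisor of some entry having a common multiple with the
previous entry, which the strong turns exclude. -/
theorem witness_irreducible (hn : Even n) (h4 : 4 ≤ n) : (witness n).Irreducible := by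
  have h := arith hn h4
  have hpos : ∀ k (a₁ a₂ a b c d : MC n), (witness n).1[k]? = some (true, a₁) →
      (witness n).1[k + 1]? = some (false, a₂) → b * a = d * a₁ → c * a = a₂ → a = 1 := by
    intro k a₁ a₂ a b c d e1 e2 h1 h2
    have e1 := eq_entry_of_witness e1
    have e2 := eq_entry_of_witness e2
    rw [entry] at e1 e2
    have hk : Even k := by
      by_contra hk
      simp [hk] at e1
    have hk' : ¬ Even (k + 1) := by simpa [Nat.even_add_one] using hk
    rw [if_pos hk] at e1
    rw [if_neg hk'] at e2
    obtain ⟨-, rfl⟩ := Prod.mk.inj e1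
    obtain ⟨-, rfl⟩ := Prod.mk.inj e2
    rw [Nat.cast_succ (k + 1)] at h2
    exact up_mul_eq h (by rwa [ev_natCast hn h4]) h1 h2
  have hneg : ∀ k (a₁ a₂ a b c d : MC n), (witness n).1[k]? = some (false, a₁) →
      (witness n).1[k + 1]? = some (true, a₂) → a * b = a₁ * d → a * c = a₂ → a = 1 := by
    intro k a₁ a₂ a b c d e1 e2 h1 h2
    have e1 := eq_entry_of_witness e1
    have e2 := eq_entry_of_witness e2
    rw [entry] at e1 e2
    have hk : ¬ Even k := by
      intro hk
      simp [hk] at e1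
    have hk' : Even (k + 1) := by simpa [Nat.even_add_one] using hk
    rw [if_neg hk] at e1
    rw [if_pos hk'] at e2
    obtain ⟨-, rfl⟩ := Prod.mk.inj e1
    obtain ⟨-, rfl⟩ := Prod.mk.inj e2
    rw [Nat.cast_succ (k + 1)] at h2
    exact mul_down_eq h (by rwa [ev_natCast hn h4]) h1 h2
  rintro ⟨⟨l', hl'⟩, i, a, ha, hr⟩
  obtain ⟨l, hl⟩ : ∃ l, (witness n).1 = l := ⟨_, rfl⟩
  rw [hl] at hpos hneg hr
  change Rule i a l l' at hr
  cases hr with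
  | pos u v a₀ a₁ a₂ b₁ b₂ _ x' hlcm h₁ h₂ =>
    exact ha (hpos (u.length + 1) a₁ a₂ a b₁ b₂ x'
      (by rw [List.getElem?_append_right (by omega), Nat.add_sub_cancel_left]; rfl)
      (by rw [List.getElem?_append_right (by omega), Nat.add_assoc, Nat.add_sub_cancel_left]; rfl)
      h₁ h₂)
  | neg u v a₀ a₁ a₂ b₁ b₂ _ x' hlcm h₁ h₂ =>
    exact ha (hneg (u.length + 1) a₁ a₂ a b₁ b₂ x'
      (by rw [List.getElem?_append_right (by omega), Nat.add_sub_cancel_left]; rfl)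
      (by rw [List.getElem?_append_right (by omega), Nat.add_assoc, Nat.add_sub_cancel_left]; rfl)
      h₁ h₂)
  | pos_one v a₁ a₂ b₁ b₂ _ h₁ h₂ =>
    -- A rule of index 1 is covered by the multiplier `d = 1`.
    exact ha (hpos 0 a₁ a₂ a b₁ b₂ 1 (by simp) (by simp) (by rw [h₁, one_mul]) h₂)
  | neg_one v a₁ a₂ b₁ b₂ _ h₁ h₂ =>
    exact ha (hneg 0 a₁ a₂ a b₁ b₂ 1 (by simp) (by simp) (by rw [h₁, mul_one]) h₂)

theorem witness_not_trivial (h4 : 4 ≤ n) : ¬ (witness n).Trivial := by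
  intro h
  have h0 : (witness n).1[0]? = some (entry n 0) := by
    rw [witness_getElem?, if_pos (by omega)]
  have h1 := h _ (List.mem_of_getElem? h0)
  have h2 : up ((0 + 1 : ℕ) : ZMod n) = 1 := h1
  rw [up, ivl_eq_one_iff] at h2
  cases h2

theorem frac_irreducible {M : Type*} [Monoid M] {a b : M}
    (h : ∀ x c d : M, c * x = a → d * x = b → x = 1) : (Multifraction.frac a b).Irreducible := by
  rintro ⟨⟨l', hl'⟩, i, x, hx, hr⟩
  obtain ⟨l, hl⟩ : ∃ l, (Multifraction.frac a b).1 = l := ⟨_, rfl⟩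
  change Rule i x (Multifraction.frac a b).1 l' at hr
  rw [hl] at hr
  have hlen : l.length = 2 := by rw [← hl]; rfl
  cases hr with
  | pos u v a₀ a₁ a₂ b₁ b₂ _ x' hlcm h₁ h₂ =>
    simp only [List.length_append, List.length_cons] at hlen
    omega
  | neg u v a₀ a₁ a₂ b₁ b₂ _ x' hlcm h₁ h₂ =>
    simp only [List.length_append, List.length_cons] at hlen
    omega
  | pos_one v a₁ a₂ b₁ b₂ _ h₁ h₂ =>
    simp only [Multifraction.frac, List.cons.injEq, Prod.mk.injEq, true_and] at hl
    obtain ⟨rfl, rfl, -⟩ := hl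
    exact hx (h x b₁ b₂ h₁ h₂)
  | neg_one v a₁ a₂ b₁ b₂ _ h₁ h₂ => simp [Multifraction.frac] at hl

end PC

end MultifractionReduction

/-! ### The main statement -/

theorem propositionC :
    (∀ n : ℕ, 4 ≤ n → Even n →
      Nat.card (PC n) = 3 * n + 1 ∧
      IsGcdMonoid (MC n) ∧
      IsNoetherianMonoid (MC n) ∧
      Function.Injective (can (MC n)) ∧
      (∀ p : ℕ, p < n → SemiConvergentUpTo (MC n) p) ∧
      ¬ SemiConvergentUpTo (MC n) n ∧
      (witness n).depth = n ∧
      (witness n).Unital ∧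
      ¬ (witness n).Trivial ∧
      (witness n).Irreducible) ∧
    ((Multifraction.frac (up 1) (down 2) : Multifraction (MC 4)) ≠
        Multifraction.frac (down 4) (up 3) ∧
      (Multifraction.frac (up 1) (down 2) : Multifraction (MC 4)).Irreducible ∧
      (Multifraction.frac (down 4) (up 3) : Multifraction (MC 4)).Irreducible ∧
      (Multifraction.frac (up 1) (down 2) : Multifraction (MC 4)).eval =
        (Multifraction.frac (down 4) (up 3) : Multifraction (MC 4)).eval) := by
  refine ⟨fun n h4 hn => ?_, ?_⟩
  · have h := PC.arith hn h4
    have hm := PC.localMeets h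
    have hm' := PC.localMeets_dual h
    have hdepth : (witness n).depth = n := by simp [witness, Multifraction.depth]
    have hu := PC.witness_unital hn h4
    have ht := PC.witness_not_trivial h4
    have hi := PC.witness_irreducible hn h4
    refine ⟨PC.card (by omega), isGcdMonoid_intervalMonoid _ PC.height_strictMono hm hm',
      isNoetherianMonoid_intervalMonoid _ PC.height_strictMono, can_injective, fun p hp => ?_, ?_,
      hdepth, hu, ht, hi⟩
    · exact semiConvergentUpTo_of_no_loop _ PC.height_strictMono hm hm' p fun l v hl =>
        PC.not_isIrredLoop h (hl.trans_lt hp) v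
    · intro hsc
      rcases Relation.ReflTransGen.cases_head ((hsc _ hdepth.le).1 hu) with he | ⟨b, hb, -⟩
      · exact ht (he ▸ Multifraction.ones_trivial _)
      · exact hi ⟨b, hb⟩
  · have h : PC.Arith 4 := PC.arith (by decide) le_rfl
    have h1 : ¬ PC.Ev (1 : ZMod 4) := by unfold PC.Ev; decide
    have h3 : ¬ PC.Ev (3 : ZMod 4) := by unfold PC.Ev; decide
    refine ⟨?_, ?_, ?_, ?_⟩
    · intro heq
      have h5 := congrArg Subtype.val heq
      simp only [Multifraction.frac, List.cons.injEq, Prod.mk.injEq, true_and] at h5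
      have h6 : ivl (P := PC 4) (PC.x 1) (PC.z 2) (PC.x_le_z_succ 1) =
        ivl (PC.x 1) (PC.z 4) (PC.x_succ_le_z 4) := h5.1
      rw [ivl_left_inj] at h6
      exact absurd (PC.z.inj h6) (by decide)
    · exact PC.frac_irreducible fun x c d hc hd =>
        PC.up_mul_eq h h1 (d := 1) (by rw [hc, one_mul]) hd
    · exact PC.frac_irreducible fun x c d hc hd =>
        PC.down_mul_eq h h3 (d := 1) (by rw [hc, one_mul]; rfl) hd
    · have hf : ∀ a b : MC 4, (Multifraction.frac a b).eval = can _ a * (can _ b)⁻¹ := by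
        intro a b
        simp [Multifraction.frac, Multifraction.eval]
      -- Both fractions telescope to `φ(x_1)⁻¹ φ(x_3)`, where `φ` is `potential`.
      rw [hf, hf, PC.can_up h, PC.can_down h, PC.can_up h, PC.can_down h]
      have e1 : (4 : ZMod 4) + 1 = 1 := by decide
      have e2 : (3 : ZMod 4) + 1 = 4 := by decide
      have e3 : (2 : ZMod 4) + 1 = 3 := by decide
      have e4 : (1 : ZMod 4) + 1 = 2 := by decide
      rw [e1, e2, e3, e4]
      group
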